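/- Let $(K,\nu)$ be a henselian valued field (with a Krull valuation $\nu$ of arbitrary rank, written additively) such that $\operatorname{char} K=0$ and the residue field $K\nu$ has characteristic $p>0$. Extend $\nu$ to an algebraic closure $K^{\mathrm{ac}}$ of $K$, and endow every algebraic extension of $K$ inside $K^{\mathrm{ac}}$ with the restriction of $\nu$. An algebraic extension $L|K$ is called purely wild if $\nu L/\nu K$ is a $p$-group and the residue field extension $L\nu|K\nu$ is purely inseparable, and immediate if $\nu L=\nu K$ and $L\nu=K\nu$. Let $\theta\in K^{\mathrm{ac}}$ be such that $K(\theta)|K$ is purely wild, and suppose that the minimal polynomial of $\theta$ over $K$ is $\mathfrak A(X)-c$, where $c\in K$ and $$\mathfrak A(X)=\sum_{i=0}^{n}a_iX^{p^i}$$ has coefficients in the valuation ring of $K$. Suppose that $\nu a_0=\nu a_n=0$, that $\nu\theta>-\frac{\nu p}{p^n}$, and that $K\nu$ is not $\mathfrak A\nu$-closed, that is, $\mathfrak A\nu(K\nu)\subsetneq K\nu$, where $\mathfrak A\nu\in K\nu[X]$ is the reduction of $\mathfrak A$. Then maximal purely wild extensions of $K$ are not unique: there are two purely wild extensions of $K$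 in $K^{\mathrm{ac}}$, each maximal under inclusion among the purely wild extensions, that are not isomorphic over $K$. If moreover $K(\theta)|K$ is immediate, then maximal immediate algebraic extensions of $K$ are not unique: there are two immediate algebraic extensions of $K$ in $K^{\mathrm{ac}}$, each maximal under inclusion among the immediate algebraic extensions, that are not isomorphic over $K$. -/

import Mathlib

open Polynomial IsLocalRing
open scoped IntermediateField

namespace PurelyWild

section Extensions

variable {K L Γ₀ Γ₁ : Type*} [Field K] [Field L] [Algebra K L]
  [LinearOrderedCommGroupWithZero Γ₀] [LinearOrderedCommGroupWithZero Γ₁]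

/-- The algebraic extension `(L|K, ν)` of valued fields is purely wild, where `p` is the (positive)
residue characteristic: `νL / νK` is a `p`-group, that is, every element of `νL` has some multiple
`p ^ k` (here a power, since valuations are written multiplicatively) that lies in `νK`, and the
residue field extension is purely inseparable. -/
structure IsPurelyWild (p : ℕ) (vK : Valuation K Γ₀) (vL : Valuation L Γ₁)
    [vK.HasExtension vL] : Prop where
  isAlgebraic : Algebra.IsAlgebraic K L
  valueGroup_isPGroup : ∀ x : L, x ≠ 0 → ∃ (k : ℕ) (y : K), vL x ^ p ^ k = vL (algebraMap K L y)
  residueField_isPurelyInseparable :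
    IsPurelyInseparable (ResidueField vK.valuationSubring) (ResidueField vL.valuationSubring)

/-- The extension `(L|K, ν)` of valued fields is immediate: `νL = νK` and `Lν = Kν`. -/
structure IsImmediate (vK : Valuation K Γ₀) (vL : Valuation L Γ₁) [vK.HasExtension vL] : Prop where
  valueGroup_eq : ∀ x : L, x ≠ 0 → ∃ y : K, vL x = vL (algebraMap K L y)
  residueField_eq : Function.Surjective
    (algebraMap (ResidueField vK.valuationSubring) (ResidueField vL.valuationSubring))

end Extensions

section Intermediate

variable {K Ω Γ₀ Γ₁ : Type*} [Field K] [Field Ω] [Algebra K Ω]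
  [LinearOrderedCommGroupWithZero Γ₀] [LinearOrderedCommGroupWithZero Γ₁]

/-- The restriction of a valuation of `Ω` to an intermediate field `L` of `Ω|K`. -/
abbrev restrictTo (w : Valuation Ω Γ₁) (L : IntermediateField K Ω) : Valuation L Γ₁ :=
  w.comap (algebraMap L Ω)

instance hasExtension_restrictTo (v : Valuation K Γ₀) (w : Valuation Ω Γ₁) [h : v.HasExtension w]
    (L : IntermediateField K Ω) : v.HasExtension (restrictTo w L) where
  val_isEquiv_comap := h.val_isEquiv_comap

/-- `L` is a maximal purely wild extension of `(K, v)` inside the algebraic closure `(Ω, w)`. -/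
def IsMaximalPurelyWild (p : ℕ) (v : Valuation K Γ₀) (w : Valuation Ω Γ₁) [v.HasExtension w]
    (L : IntermediateField K Ω) : Prop :=
  Maximal (fun M : IntermediateField K Ω => IsPurelyWild p v (restrictTo w M)) L

/-- `L` is a maximal immediate algebraic extension of `(K, v)` inside the algebraic closure
`(Ω, w)`. -/
def IsMaximalImmediateAlgebraic (v : Valuation K Γ₀) (w : Valuation Ω Γ₁) [v.HasExtension w]
    (L : IntermediateField K Ω) : Prop :=
  Maximal (fun M : IntermediateField K Ω =>
    Algebra.IsAlgebraic K M ∧ IsImmediate v (restrictTo w M)) L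

end Intermediate

/-- The polynomial `𝔄(X) = ∑_{i = 0}^{n} a_i X^{p^i}`. -/
noncomputable def additiveForm {R : Type*} [CommRing R] (p n : ℕ) (a : ℕ → R) : R[X] :=
  ∑ i ∈ Finset.range (n + 1), C (a i) * X ^ p ^ i

/-- The field `k` is `f`-closed: `f(k) = k`. -/
def IsPolyClosed {k : Type*} [Field k] (f : k[X]) : Prop :=
  Set.range (fun x : k => f.eval x) = Set.univ

end PurelyWild

/-!
Write `𝔄` for the additive polynomial and `k` for the residue field of `K`, and choose `b` in the
valuation ring of `K` whose residue is not a value of the reduction of `𝔄` on `k`. Let `θ'` be a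
root of `𝔄(X) - (c + b)`. Since the binomial coefficients in `(T + u) ^ p ^ i` are divisible by `p`
and `ν(p θ ^ p ^ n) > 0` in additive notation, the polynomial `𝔄` is additive at `θ` up to terms of
positive value. So `x = θ' - θ` is integral, and its residue `z` is a root of `𝔄(X) = b` over `k`,
an equation that is separable because `a₀` is a unit (`val_le_one_of_eval_add_eq`,
`isSeparable_residue_of_val_sub_lt_one`).

A purely wild extension `W` of `K` cannot contain both `θ` and a root of `𝔄(X) - (c + b)`: otherwise
`z`, which is separable over `k`, would lie in the purely inseparable extension `Wν` of `k`, hence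
in `k`, against the choice of `b` (`false_of_mem_of_mem`). Therefore a maximal purely wild extension
containing `θ` is not isomorphic over `K` to one containing `θ'`, and likewise for immediate
extensions. Such maximal extensions exist by Zorn's lemma because both properties can be tested
element by element. It remains to see that `K(θ')` is purely wild (immediate) if `K(θ)` is
(`exists_translate`).

For this, lift `z` to `η` with `[K(η) : K] = [k(z) : k]`. By an argument of Krasner type, `K(θ, η) =
K(θ', η)`. The elements `1, η, …, η ^ (d - 1)` form a valuation basis of `K(θ, η)` over `K(θ)`,
because `z` keeps its degree `d` over the purely inseparable extension `K(θ)ν` of `k`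
(`exists_val_sum_eq`). So the value group does not grow, and a high `p`-power `u` of a residue of
`K(θ')` lies in `k(z)`. This `u` is separable over `k` and lifts to an element of `K(θ') ∩ K(η)`,
which is `K` by comparison of degrees (`eq_bot_of_le_of_le_of_finrank_sup`); so `u ∈ k`.

All of these arguments use the henselian hypothesis in one form only: every `K`-automorphism of the
algebraic closure preserves the valuation (`val_algEquiv_lt_one`). This is deduced from lifting of
simple roots in two stages: the integral closure of a henselian local ring in a finite Galois
extension is local (`isLocalRing_of_isInvariant`), and therefore the valuation ring of the algebraic
closure is the integral closure of the one of `K` (`isIntegral_of_val_le_one`).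
-/

namespace PurelyWild

/-! ### Finite group invariants and henselian local rings -/

section LocalRing

open scoped Pointwise

/-- By the Chinese remainder theorem for the finitely many conjugates of a maximal ideal `P`, some
element is congruent to `1` modulo `P` and lies in all other conjugates of `P`. -/
theorem exists_forall_mem_smul_of_isMaximal {B G : Type*} [CommRing B] [Group G] [Finite G]
    [MulSemiringAction G B] (P : Ideal B) [hP : P.IsMaximal] :
    ∃ β : B, β - 1 ∈ P ∧ ∀ g : G, g • P ≠ P → β ∈ g • P := by
  classical
  cases nonempty_fintype G
  set J : Ideal B := Finset.inf {g : G | g • P ≠ P} (fun g => g • P) with hJ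
  have hJP : ¬ J ≤ P := by
    intro h
    rw [hJ, hP.isPrime.inf_le'] at h
    obtain ⟨g, hg, hle⟩ := h
    have : (g • P).IsMaximal := by
      rw [Ideal.pointwise_smul_eq_comap]
      exact Ideal.comap_isMaximal_of_equiv (MulSemiringAction.toRingEquiv G B g).symm
    exact (Finset.mem_filter.mp hg).2 (this.eq_of_le hP.ne_top hle)
  have htop : J ⊔ P = ⊤ := by
    rw [sup_comm]
    exact hP.out.2 _ (lt_of_le_of_ne le_sup_left fun h => hJP (h ▸ le_sup_right))
  obtain ⟨β, hβ, π, hπ, h1⟩ := Submodule.mem_sup.mp ((Ideal.eq_top_iff_one _).mp htop)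
  refine ⟨β, ?_, fun g hg => ?_⟩
  · rw [← h1]
    simpa using P.neg_mem hπ
  have : J ≤ g • P := Finset.inf_le (by simpa using hg)
  exact this hβ

/-- A domain `B` with a finite group action whose invariants are a henselian local ring `A` is
local. If `P` is one of several maximal ideals, there is `γ`, fixed by the stabilizer of `P`, with
`γ ≡ 1` modulo `P` and `γ` in every other maximal ideal. The product of `X - s` over the conjugates
`s` of `γ` has coefficients in `A` and reduces to `(X - 1) X ^ r` modulo `P`, so it has a root in
`A` by Hensel's lemma; this forces `γ ∈ A`, which is absurd. -/
theorem isLocalRing_of_isInvariant (A B G : Type*) [CommRing A] [HenselianLocalRing A] [CommRing B]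
    [IsDomain B] [Algebra A B] [Group G] [Finite G] [MulSemiringAction G B] [SMulCommClass G A B]
    [Algebra.IsInvariant A B G] : IsLocalRing B := by
  classical
  cases nonempty_fintype G
  have hint : Algebra.IsIntegral A B := Algebra.IsInvariant.isIntegral A B G
  obtain ⟨P, hP⟩ := Ideal.exists_maximal B
  refine IsLocalRing.of_unique_max_ideal ⟨P, hP, fun Q hQ => ?_⟩
  by_contra hQP
  have hunder (I : Ideal B) [I.IsMaximal] : I.under A = maximalIdeal A :=
    IsLocalRing.eq_maximalIdeal (Ideal.isMaximal_comap_of_isIntegral_of_isMaximal I)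
  have hPA (a : A) : algebraMap A B a ∈ P ↔ a ∈ maximalIdeal A := by rw [← hunder P]; rfl
  have hQA (a : A) : algebraMap A B a ∈ Q ↔ a ∈ maximalIdeal A := by rw [← hunder Q]; rfl
  obtain ⟨q, rfl⟩ := Algebra.IsInvariant.exists_smul_of_under_eq A B G P Q
    ((hunder P).trans (hunder Q).symm)
  obtain ⟨β, hβ1, hβ⟩ := exists_forall_mem_smul_of_isMaximal (G := G) P
  let D : Finset G := {g : G | g • P = P}
  have hD (g : G) : g ∈ D ↔ g • P = P := by simp [D]
  set γ : B := ∏ g ∈ D, g • β with hγ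
  have hγ1 : γ - 1 ∈ P := by
    rw [← Ideal.Quotient.eq, hγ, map_prod]
    simp only [map_one]
    refine Finset.prod_eq_one fun g hg => ?_
    rw [← map_one (Ideal.Quotient.mk P), Ideal.Quotient.eq]
    have := Ideal.smul_mem_pointwise_smul g _ _ hβ1
    rwa [(hD g).mp hg, smul_sub, MulSemiringAction.smul_one] at this
  have hγmem (g : G) (hg : g • P ≠ P) : γ ∈ g • P :=
    (g • P).mem_of_dvd (Finset.dvd_prod_of_mem _ ((hD 1).mpr (one_smul G P)))
      (by rw [one_smul]; exact hβ g hg)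
  have hγD (g : G) (hg : g • P = P) : g • γ = γ := by
    rw [hγ, Finset.smul_prod']
    refine Finset.prod_bij (fun x _ => g * x) (fun x hx => ?_) (fun x _ y _ h => mul_left_cancel h)
      (fun x hx => ⟨g⁻¹ * x, ?_, by simp⟩) (fun x _ => by rw [mul_smul])
    · rw [hD, mul_smul, (hD x).mp hx, hg]
    · rw [hD, mul_smul, (hD x).mp hx, inv_smul_eq_iff, hg]
  let S : Finset B := Finset.univ.image fun g : G => g • γ
  have hγS : γ ∈ S := Finset.mem_image.mpr ⟨1, Finset.mem_univ _, one_smul _ _⟩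
  have hS (s : B) (hs : s ∈ S) (hne : s ≠ γ) : s ∈ P := by
    obtain ⟨g, -, rfl⟩ := Finset.mem_image.mp hs
    have hg : g⁻¹ • P ≠ P := fun h => hne (hγD g (by rw [← h, smul_inv_smul, h]))
    have := Ideal.smul_mem_pointwise_smul g _ _ (hγmem _ hg)
    rwa [smul_inv_smul] at this
  set F : B[X] := ∏ s ∈ S, (X - C s) with hF
  have hFmonic : F.Monic := monic_prod_of_monic _ _ fun s _ => monic_X_sub_C s
  have hFinv (g : G) : g • F = F := by
    rw [hF, Finset.smul_prod']
    refine Finset.prod_bij (fun x _ => g • x) (fun x hx => ?_)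
      (fun x _ y _ h => smul_left_cancel g h) (fun x hx => ?_) (fun x _ => ?_)
    · obtain ⟨h, -, rfl⟩ := Finset.mem_image.mp hx
      exact Finset.mem_image.mpr ⟨g * h, Finset.mem_univ _, mul_smul _ _ _⟩
    · obtain ⟨h, -, rfl⟩ := Finset.mem_image.mp hx
      exact ⟨(g⁻¹ * h) • γ, Finset.mem_image.mpr ⟨_, Finset.mem_univ _, rfl⟩, by
        rw [smul_smul]; simp⟩
    · rw [smul_sub, Polynomial.smul_X, smul_C]
  have hFlift : F ∈ Polynomial.lifts (algebraMap A B) :=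
    F.lifts_iff_coeff_lifts.mpr fun n =>
      Algebra.IsInvariant.isInvariant (G := G) _ fun g => by rw [← coeff_smul, hFinv]
  obtain ⟨f, hf, -, hfmonic⟩ := lifts_and_natDegree_eq_and_monic hFlift hFmonic
  have hFfac : F = (X - C γ) * ∏ s ∈ S.erase γ, (X - C s) := (Finset.mul_prod_erase S _ hγS).symm
  -- The roots other than `γ` lie in `P`, so that `1` is a simple root of `F` modulo `P`.
  have hother : (∏ s ∈ S.erase γ, (X - C s)).eval 1 - 1 ∈ P := by
    rw [← Ideal.Quotient.eq, eval_prod, map_prod]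
    simp only [map_one]
    refine Finset.prod_eq_one fun s hs => ?_
    rw [← map_one (Ideal.Quotient.mk P), Ideal.Quotient.eq]
    simpa using hS s (Finset.mem_of_mem_erase hs) (Finset.ne_of_mem_erase hs)
  have hγ1' : 1 - γ ∈ P := by simpa using P.neg_mem hγ1
  have h0 : f.eval 1 ∈ maximalIdeal A := by
    rw [← hPA, ← Polynomial.eval₂_at_apply, ← eval_map, hf, hFfac]
    simpa using P.mul_mem_right _ hγ1'
  have h1 : IsUnit (f.derivative.eval 1) := by
    rw [← IsLocalRing.notMem_maximalIdeal, ← hPA, ← Polynomial.eval₂_at_apply, ← eval_map,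
      ← derivative_map, hf, hFfac]
    intro hmem
    simp only [derivative_mul, derivative_sub, derivative_X, derivative_C, sub_zero, one_mul,
      eval_add, eval_mul, eval_sub, eval_X, eval_C, map_one] at hmem
    have h2 := P.sub_mem hmem hother
    have h3 := P.sub_mem h2
      (P.mul_mem_right (eval 1 (derivative (∏ s ∈ S.erase γ, (X - C s)))) hγ1')
    refine hP.ne_top ((Ideal.eq_top_iff_one _).mpr ?_)
    convert h3 using 1
    ring
  obtain ⟨a, ha, -⟩ := HenselianLocalRing.is_henselian f hfmonic 1 h0 h1
  have haS : algebraMap A B a ∈ S := by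
    have : F.eval (algebraMap A B a) = 0 := by
      rw [← hf, eval_map, eval₂_at_apply, ha.eq_zero, map_zero]
    rw [hF, eval_prod, Finset.prod_eq_zero_iff] at this
    obtain ⟨s, hs, h⟩ := this
    rw [eval_sub, eval_X, eval_C, sub_eq_zero] at h
    rwa [h]
  obtain ⟨g, -, hg⟩ := Finset.mem_image.mp haS
  -- The root found in `A` is a conjugate of `γ`, and it is invariant, so it equals `γ`.
  have haγ : algebraMap A B a = γ := by
    have h := congrArg (g⁻¹ • ·) hg
    simpa using h.symm
  have haP : a ∈ maximalIdeal A := by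
    rw [← hQA, haγ]
    exact hγmem q hQP
  refine hP.ne_top ((Ideal.eq_top_iff_one _).mpr ?_)
  have := P.sub_mem ((hPA a).mpr haP) (haγ ▸ hγ1)
  simpa [haγ] using this

end LocalRing

/-! ### Galois invariance of the valuation over a henselian field -/

section GaloisInvariance

variable {K Ω Γ₀ Γ₁ : Type*} [Field K] [Field Ω] [Algebra K Ω]
  [LinearOrderedCommGroupWithZero Γ₀] [LinearOrderedCommGroupWithZero Γ₁]
  (v : Valuation K Γ₀) (w : Valuation Ω Γ₁) [v.HasExtension w]

theorem val_le_one_of_isIntegral {z : Ω} (hz : IsIntegral v.valuationSubring z) : w z ≤ 1 := by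
  have h : IsIntegral w.valuationSubring z := hz.tower_top
  obtain ⟨y, rfl⟩ := IsIntegrallyClosed.isIntegral_iff.mp h
  exact y.2

/-- The normal closure of `K(y)` is finite Galois over `K`, so the integral closure of the valuation
ring in it is local; its maximal ideal is the set of elements of value `< 1`. -/
theorem isIntegral_inv_of_val_eq_one [CharZero K] [IsAlgClosure K Ω]
    [HenselianLocalRing v.valuationSubring] {y : Ω} (hy : IsIntegral v.valuationSubring y)
    (hwy : w y = 1) : IsIntegral v.valuationSubring y⁻¹ := by
  have : IsAlgClosed Ω := IsAlgClosure.isAlgClosed K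
  have : Algebra.IsAlgebraic K Ω := IsAlgClosure.isAlgebraic
  have : Normal K Ω := IsAlgClosure.normal K Ω
  have hyK : IsIntegral K y := Algebra.IsIntegral.isIntegral y
  have : FiniteDimensional K K⟮y⟯ := IntermediateField.adjoin.finiteDimensional hyK
  let N : IntermediateField K Ω := IntermediateField.normalClosure K K⟮y⟯ Ω
  have : IsGalois K N := ⟨⟩
  have hyN : y ∈ N := K⟮y⟯.le_normalClosure (IntermediateField.mem_adjoin_simple_self K y)
  let B := integralClosure v.valuationSubring N
  have : IsFractionRing B N :=
    IsIntegralClosure.isFractionRing_of_finite_extension v.valuationSubring K N B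
  have : Algebra.IsInvariant v.valuationSubring B (B ≃ₐ[v.valuationSubring] B) :=
    Algebra.isInvariant_of_isGalois' v.valuationSubring K N B
  have : Finite (B ≃ₐ[v.valuationSubring] B) :=
    .of_equiv _ (galRestrict v.valuationSubring K N B).toEquiv
  have : IsLocalRing B :=
    isLocalRing_of_isInvariant v.valuationSubring B (B ≃ₐ[v.valuationSubring] B)
  have hint (b : B) : IsIntegral v.valuationSubring ((b : N) : Ω) :=
    b.2.algebraMap (B := Ω)
  let φ : B →+* w.valuationSubring :=
    ((algebraMap N Ω).comp (algebraMap B N)).codRestrict w.valuationSubring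
      fun b => val_le_one_of_isIntegral v w (hint b)
  let P : Ideal B := (maximalIdeal w.valuationSubring).comap φ
  have hP : P.IsMaximal := by
    refine Ideal.isMaximal_of_isIntegral_of_isMaximal_comap (R := v.valuationSubring) P ?_
    convert maximalIdeal.isMaximal v.valuationSubring
    rw [← Valuation.HasExtension.maximalIdeal_comap_algebraMap_eq_maximalIdeal v w]
    rfl
  let b : B := ⟨⟨y, hyN⟩, (isIntegral_algHom_iff (N.val.restrictScalars v.valuationSubring)
    N.val.injective).mp hy⟩
  have hb : IsUnit b := by
    rw [← IsLocalRing.notMem_maximalIdeal, ← IsLocalRing.eq_maximalIdeal hP]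
    intro h
    have h2 : φ b ∈ maximalIdeal w.valuationSubring := h
    rw [Valuation.mem_maximalIdeal_iff] at h2
    exact h2.ne hwy
  obtain ⟨c, hc⟩ := hb.exists_right_inv
  have hc' : y * ((c : N) : Ω) = 1 := congrArg (fun x : B => ((x : N) : Ω)) hc
  rw [inv_eq_of_mul_eq_one_right hc']
  exact hint c

/-- If `z` is a root of a polynomial with integral coefficients, then the leading coefficient times
`z` is integral. -/
theorem isIntegral_mul_of_sum_eq_zero {z : Ω} {d : ℕ} {a : ℕ → Ω}
    (ha : ∀ i, IsIntegral v.valuationSubring (a i))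
    (hz : ∑ i ∈ Finset.range (d + 1), a i * z ^ i = 0) :
    IsIntegral v.valuationSubring (a d * z) := by
  by_cases had : a d = 0
  · rw [had, zero_mul]
    exact isIntegral_zero
  let B := integralClosure v.valuationSubring Ω
  let b : ℕ → B := fun i => ⟨a i, ha i⟩
  let f : B[X] := ∑ i ∈ Finset.range (d + 1), C (b i) * X ^ i
  have hcoeff : f.coeff d = b d := by
    simp [f, coeff_C_mul, coeff_X_pow]
  have hdeg : f.natDegree ≤ d :=
    natDegree_sum_le_of_forall_le _ _ fun i hi =>
      (natDegree_C_mul_X_pow_le _ _).trans (Finset.mem_range_succ_iff.mp hi)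
  have hbd : b d ≠ 0 := fun h => had (congrArg Subtype.val h)
  have hlead : f.leadingCoeff = b d := by
    rw [leadingCoeff, natDegree_eq_of_le_of_coeff_ne_zero hdeg (hcoeff ▸ hbd), hcoeff]
  have h0 : aeval z f = 0 := by
    simp only [f, map_sum, map_mul, aeval_C, map_pow, aeval_X]
    exact hz
  have h := isIntegral_leadingCoeff_smul f z h0
  rw [hlead] at h
  exact isIntegral_trans (A := B) _ h

/-- If `w z ≤ 1` and `z` is a root of a polynomial with integral coefficients, one of which is a
unit for `w`, then `z` is a quotient of integral elements with denominator a unit for `w`. A leading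
coefficient `a` that is not a unit is absorbed into the next coefficient as `a * z`, which is
integral. -/
theorem exists_isIntegral_mul_of_sum_eq_zero {z : Ω} (hwz : w z ≤ 1) (d : ℕ) :
    ∀ a : ℕ → Ω, (∀ i, IsIntegral v.valuationSubring (a i)) →
      ∑ i ∈ Finset.range (d + 1), a i * z ^ i = 0 → (∃ i ≤ d, w (a i) = 1) →
      ∃ y : Ω, IsIntegral v.valuationSubring y ∧ IsIntegral v.valuationSubring (y * z) ∧
        w y = 1 := by
  induction d with
  | zero =>
    intro a ha hz ⟨i, hi, hwi⟩
    obtain rfl : i = 0 := by lia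
    simp only [zero_add, Finset.range_one, Finset.sum_singleton, pow_zero, mul_one] at hz
    simp [hz] at hwi
  | succ d ih =>
    intro a ha hz ⟨i, hi, hwi⟩
    have hint := isIntegral_mul_of_sum_eq_zero v ha hz
    rcases (val_le_one_of_isIntegral v w (ha (d + 1))).eq_or_lt with h1 | h1
    · exact ⟨a (d + 1), ha _, hint, h1⟩
    refine ih (Function.update a d (a d + a (d + 1) * z)) (fun j => ?_) ?_ ⟨i, ?_, ?_⟩
    · rcases eq_or_ne j d with rfl | hj
      · simpa using (ha j).add hint
      · simpa [hj] using ha j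
    · rw [Finset.sum_range_succ, Finset.sum_range_succ] at hz
      rw [Finset.sum_range_succ, ← hz, Function.update_self, add_assoc]
      congr 1
      · refine Finset.sum_congr rfl fun j hj => ?_
        rw [Function.update_of_ne (Finset.mem_range.mp hj).ne]
      · ring
    · rcases hi.eq_or_lt with rfl | hi
      · exact absurd hwi h1.ne
      · lia
    · rcases eq_or_ne i d with rfl | hj
      · rw [Function.update_self, ← hwi]
        refine Valuation.map_add_eq_of_lt_left w ?_
        rw [hwi, map_mul]
        exact mul_lt_one_of_lt_of_le h1 hwz
      · simpa [hj] using hwi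

/-- The valuation ring of an algebraic closure of a henselian field is the integral closure of the
valuation ring of the field. -/
theorem isIntegral_of_val_le_one [CharZero K] [IsAlgClosure K Ω]
    [HenselianLocalRing v.valuationSubring] {z : Ω} (hz : w z ≤ 1) :
    IsIntegral v.valuationSubring z := by
  have : Algebra.IsAlgebraic K Ω := IsAlgClosure.isAlgebraic
  have hzK : IsIntegral K z := Algebra.IsIntegral.isIntegral z
  let g := minpoly K z
  obtain ⟨m, hm, hmax⟩ := Finset.exists_max_image (Finset.range (g.natDegree + 1))
    (fun i => v (g.coeff i)) ⟨0, by simp⟩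
  have hgm : g.coeff m ≠ 0 := by
    intro h0
    have h := hmax g.natDegree (by simp)
    rw [h0, map_zero, le_zero_iff, map_eq_zero] at h
    exact minpoly.ne_zero hzK (leadingCoeff_eq_zero.mp h)
  have hmax' (i : ℕ) : v (g.coeff i / g.coeff m) ≤ 1 := by
    rw [map_div₀]
    refine div_le_one_of_le₀ ?_ zero_le
    rcases le_or_gt i g.natDegree with hi | hi
    · exact hmax i (by simpa [Nat.lt_succ_iff] using hi)
    · rw [coeff_eq_zero_of_natDegree_lt hi, map_zero]
      exact zero_le
  obtain ⟨y, hy, hyz, hwy⟩ := exists_isIntegral_mul_of_sum_eq_zero v w hz g.natDegree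
    (fun i => algebraMap K Ω (g.coeff i / g.coeff m))
    (fun i => isIntegral_algebraMap (A := Ω)
      (x := (⟨g.coeff i / g.coeff m, hmax' i⟩ : v.valuationSubring))) (by
      have h := minpoly.aeval K z
      rw [aeval_eq_sum_range] at h
      simp only [Algebra.smul_def] at h
      calc _ = (algebraMap K Ω (g.coeff m))⁻¹ *
            ∑ i ∈ Finset.range (g.natDegree + 1), algebraMap K Ω (g.coeff i) * z ^ i := by
              rw [Finset.mul_sum]
              refine Finset.sum_congr rfl fun i _ => ?_
              rw [map_div₀]
              ring
        _ = 0 := by rw [h, mul_zero])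
    ⟨m, Finset.mem_range_succ_iff.mp hm, by rw [div_self hgm, map_one, map_one]⟩
  have h := (isIntegral_inv_of_val_eq_one v w hy hwy).mul hyz
  rwa [inv_mul_cancel_left₀] at h
  rintro rfl
  simp at hwy

theorem val_algEquiv_le_one [CharZero K] [IsAlgClosure K Ω]
    [HenselianLocalRing v.valuationSubring] (σ : Gal(Ω/K)) {z : Ω} (hz : w z ≤ 1) :
    w (σ z) ≤ 1 :=
  val_le_one_of_isIntegral v w ((isIntegral_of_val_le_one v w hz).map
    (σ.toAlgHom.restrictScalars v.valuationSubring))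

theorem val_algEquiv_lt_one [CharZero K] [IsAlgClosure K Ω]
    [HenselianLocalRing v.valuationSubring] (σ : Gal(Ω/K)) {z : Ω} (hz : w z < 1) :
    w (σ z) < 1 := by
  by_contra! h
  have hσz : w (σ z)⁻¹ ≤ 1 := by
    rw [map_inv₀]
    exact inv_le_one_of_one_le₀ h
  have h2 := val_algEquiv_le_one v w σ.symm hσz
  rw [map_inv₀, AlgEquiv.symm_apply_apply, map_inv₀] at h2
  have hz0 : w z ≠ 0 := by
    intro h0
    rw [map_eq_zero] at h0
    simp [h0] at h
  exact absurd ((inv_le_one₀ (zero_lt_iff.mpr hz0)).mp h2) hz.not_ge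

end GaloisInvariance

/-! ### Approximate additivity of additive polynomials -/

section AdditivePolynomial

theorem eval_additiveForm {R : Type*} [CommRing R] (p n : ℕ) (a : ℕ → R) (x : R) :
    (additiveForm p n a).eval x = ∑ i ∈ Finset.range (n + 1), a i * x ^ p ^ i := by
  simp [additiveForm, eval_finsetSum]

theorem map_additiveForm {R S : Type*} [CommRing R] [CommRing S] (f : R →+* S) (p n : ℕ)
    (a : ℕ → R) : (additiveForm p n a).map f = additiveForm p n fun i => f (a i) := by
  simp [additiveForm, Polynomial.map_sum]

variable {Ω Γ : Type*} [Field Ω] [LinearOrderedCommGroupWithZero Γ] (w : Valuation Ω Γ)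

theorem val_natCast_le_one (m : ℕ) : w (m : Ω) ≤ 1 :=
  natCast_mem w.valuationSubring m

variable {w} {p n : ℕ} [hp : Fact p.Prime] {T u : Ω}

/-- The mixed terms of `(T + u) ^ p ^ i` are divisible by `p`, and `p * T ^ j` has value `< 1` for
`j ≤ p ^ n`. -/
theorem val_add_pow_sub_lt (hpw : w (p : Ω) < 1) (hT : w T ^ p ^ n * w (p : Ω) < 1)
    (hu : u ≠ 0) {i : ℕ} (hi : i ≤ n) :
    w ((T + u) ^ p ^ i - T ^ p ^ i - u ^ p ^ i) < max (w u) (w u ^ p ^ i) := by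
  have hwu : 0 < w u := zero_lt_iff.mpr (by simpa using hu)
  have hpos : 0 < max (w u) (w u ^ p ^ i) := lt_max_of_lt_left hwu
  rw [(Commute.all T u).add_pow_prime_pow_eq' hp.out, add_assoc, add_sub_cancel_left,
    add_sub_cancel_left, Finset.mul_sum]
  refine w.map_sum_lt hpos.ne' fun k hk => ?_
  obtain ⟨hk0, hki⟩ := Finset.mem_Ioo.mp hk
  have h1 : w T ^ k * w (p : Ω) < 1 := by
    rcases le_or_gt (w T) 1 with h | h
    · rw [mul_comm]
      exact mul_lt_one_of_lt_of_le hpw (pow_le_one₀ zero_le h)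
    · refine lt_of_le_of_lt ?_ hT
      gcongr
      · exact h.le
      · exact hki.le.trans (Nat.pow_le_pow_right hp.out.pos hi)
  have h2 : w u ^ (p ^ i - k) ≤ max (w u) (w u ^ p ^ i) := by
    rcases le_or_gt (w u) 1 with h | h
    · exact le_max_of_le_left (pow_le_of_le_one zero_le h (by lia))
    · exact le_max_of_le_right (pow_le_pow_right₀ h.le (by lia))
  calc _ = (w T ^ k * w (p : Ω)) * w u ^ (p ^ i - k) * w (((p ^ i).choose k / p : ℕ) : Ω) := by
        simp only [map_mul, map_pow]
        ac_rfl
    _ ≤ (w T ^ k * w (p : Ω)) * w u ^ (p ^ i - k) * 1 := by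
        gcongr
        exact val_natCast_le_one w _
    _ < 1 * max (w u) (w u ^ p ^ i) := by
        rw [mul_one]
        exact mul_lt_mul_of_lt_of_le_of_nonneg_of_pos h1 h2 zero_le hpos
    _ = _ := one_mul _

variable {a : ℕ → Ω}

theorem additiveForm_eval_add (p n : ℕ) (a : ℕ → Ω) (T u : Ω) :
    (additiveForm p n a).eval (T + u) - (additiveForm p n a).eval T =
      (additiveForm p n a).eval u +
      ∑ i ∈ Finset.range (n + 1), a i * ((T + u) ^ p ^ i - T ^ p ^ i - u ^ p ^ i) := by
  simp only [eval_additiveForm, ← Finset.sum_sub_distrib, ← Finset.sum_add_distrib]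
  exact Finset.sum_congr rfl fun i _ => by ring

/-- On integral increments `u`, the polynomial is additive at `T` up to terms of value `< 1`. -/
theorem val_additiveForm_eval_add_sub_lt_one (hpw : w (p : Ω) < 1)
    (hT : w T ^ p ^ n * w (p : Ω) < 1) (ha : ∀ i, w (a i) ≤ 1) (hu : w u ≤ 1) :
    w ((additiveForm p n a).eval (T + u) - (additiveForm p n a).eval T -
      (additiveForm p n a).eval u) < 1 := by
  rw [additiveForm_eval_add, add_sub_cancel_left]
  refine w.map_sum_lt one_ne_zero fun i hi => ?_
  rw [map_mul, mul_comm]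
  refine mul_lt_one_of_lt_of_le ?_ (ha i)
  rcases eq_or_ne u 0 with rfl | hu0
  · simp [hp.out.ne_zero]
  refine (val_add_pow_sub_lt hpw hT hu0 (Finset.mem_range_succ_iff.mp hi)).trans_le ?_
  exact max_le hu (pow_le_one₀ zero_le hu)

/-- The linear term dominates on increments of value `< 1`. In particular, distinct roots `T`, `T +
u` of a translate of the additive polynomial satisfy `1 ≤ w u`. -/
theorem val_additiveForm_eval_add_sub_eq (hpw : w (p : Ω) < 1)
    (hT : w T ^ p ^ n * w (p : Ω) < 1) (ha : ∀ i, w (a i) ≤ 1) (ha₀ : w (a 0) = 1)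
    (hu0 : u ≠ 0) (hu : w u < 1) :
    w ((additiveForm p n a).eval (T + u) - (additiveForm p n a).eval T) = w u := by
  have hwu : 0 < w u := zero_lt_iff.mpr (by simpa using hu0)
  rw [additiveForm_eval_add, eval_additiveForm, Finset.sum_range_succ', pow_zero, pow_one]
  have h0 : w (a 0 * u) = w u := by rw [map_mul, ha₀, one_mul]
  have h1 : w (∑ i ∈ Finset.range n, a (i + 1) * u ^ p ^ (i + 1)) < w u := by
    refine w.map_sum_lt hwu.ne' fun i _ => ?_
    rw [map_mul, map_pow]
    refine (mul_le_of_le_one_left zero_le (ha _)).trans_lt ?_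
    exact pow_lt_self_of_lt_one₀ hwu hu (Nat.one_lt_pow i.succ_ne_zero hp.out.one_lt)
  have h2 : w (∑ i ∈ Finset.range (n + 1), a i * ((T + u) ^ p ^ i - T ^ p ^ i - u ^ p ^ i)) <
      w u := by
    refine w.map_sum_lt hwu.ne' fun i hi => ?_
    rw [map_mul]
    refine (mul_le_of_le_one_left zero_le (ha i)).trans_lt ?_
    refine (val_add_pow_sub_lt hpw hT hu0 (Finset.mem_range_succ_iff.mp hi)).trans_le ?_
    exact max_le le_rfl (pow_le_of_le_one zero_le hu.le (pow_ne_zero _ hp.out.ne_zero))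
  have h3 : w ((∑ i ∈ Finset.range n, a (i + 1) * u ^ p ^ (i + 1)) + a 0 * u) = w u := by
    rw [Valuation.map_add_eq_of_lt_right w (by rwa [h0]), h0]
  rw [Valuation.map_add_eq_of_lt_left w (by rwa [h3]), h3]

/-- The leading term dominates on increments of value `> 1`. -/
theorem one_lt_val_additiveForm_eval_add_sub (hpw : w (p : Ω) < 1)
    (hT : w T ^ p ^ n * w (p : Ω) < 1) (ha : ∀ i, w (a i) ≤ 1) (haₙ : w (a n) = 1)
    (hu : 1 < w u) :
    1 < w ((additiveForm p n a).eval (T + u) - (additiveForm p n a).eval T) := by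
  have hu0 : u ≠ 0 := by
    rintro rfl
    simp at hu
  have hpn : w u ^ p ^ n ≠ 0 := pow_ne_zero _ (by simpa using hu0)
  rw [additiveForm_eval_add, eval_additiveForm, Finset.sum_range_succ]
  have h0 : w (a n * u ^ p ^ n) = w u ^ p ^ n := by rw [map_mul, haₙ, one_mul, map_pow]
  have h1 : w (∑ i ∈ Finset.range n, a i * u ^ p ^ i) < w u ^ p ^ n := by
    refine w.map_sum_lt hpn fun i hi => ?_
    rw [map_mul, map_pow]
    refine (mul_le_of_le_one_left zero_le (ha _)).trans_lt ?_
    exact pow_lt_pow_right₀ hu (Nat.pow_lt_pow_right hp.out.one_lt (Finset.mem_range.mp hi))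
  have h2 : w (∑ i ∈ Finset.range (n + 1), a i * ((T + u) ^ p ^ i - T ^ p ^ i - u ^ p ^ i)) <
      w u ^ p ^ n := by
    refine w.map_sum_lt hpn fun i hi => ?_
    rw [map_mul]
    refine (mul_le_of_le_one_left zero_le (ha i)).trans_lt ?_
    have hi' := Finset.mem_range_succ_iff.mp hi
    refine (val_add_pow_sub_lt hpw hT hu0 hi').trans_le (max_le ?_ ?_)
    · exact le_self_pow₀ hu.le (pow_ne_zero _ hp.out.ne_zero)
    · exact pow_le_pow_right₀ hu.le (Nat.pow_le_pow_right hp.out.pos hi')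
  have h3 : w ((∑ i ∈ Finset.range n, a i * u ^ p ^ i) + a n * u ^ p ^ n) = w u ^ p ^ n := by
    rw [Valuation.map_add_eq_of_lt_right w (by rwa [h0]), h0]
  rw [Valuation.map_add_eq_of_lt_left w (by rwa [h3]), h3]
  exact one_lt_pow₀ hu (pow_ne_zero _ hp.out.ne_zero)

end AdditivePolynomial

/-! ### Elementwise criteria for purely wild and immediate extensions -/

section Residues

variable {K Ω Γ₀ Γ₁ : Type*} [Field K] [Field Ω] [Algebra K Ω]
  [LinearOrderedCommGroupWithZero Γ₀] [LinearOrderedCommGroupWithZero Γ₁]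

theorem residue_eq_residue_iff {w : Valuation Ω Γ₁} (x y : w.valuationSubring) :
    residue w.valuationSubring x = residue w.valuationSubring y ↔ w ((x : Ω) - y) < 1 := by
  rw [← sub_eq_zero, ← map_sub, residue_eq_zero_iff, Valuation.mem_maximalIdeal_iff]
  rfl

variable (v : Valuation K Γ₀) (w : Valuation Ω Γ₁) [v.HasExtension w]

/-- No integrality of `b` is required on the right, since it follows from that of `x`. -/
theorem residue_mem_range_iff (x : w.valuationSubring) :
    residue w.valuationSubring x ∈ (algebraMap (ResidueField v.valuationSubring)
      (ResidueField w.valuationSubring)).range ↔ ∃ b : K, w ((x : Ω) - algebraMap K Ω b) < 1 := by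
  constructor
  · rintro ⟨c, hc⟩
    obtain ⟨b, rfl⟩ := residue_surjective c
    rw [Valuation.HasExtension.algebraMap_residue_eq_residue_algebraMap, eq_comm,
      residue_eq_residue_iff] at hc
    exact ⟨b, hc⟩
  · rintro ⟨b, hb⟩
    have hb1 : w (algebraMap K Ω b) ≤ 1 := by
      have : algebraMap K Ω b = x - (x - algebraMap K Ω b) := by ring
      rw [this]
      exact (w.map_sub _ _).trans (max_le x.2 hb.le)
    rw [Valuation.HasExtension.val_map_le_one_iff v w] at hb1
    refine ⟨residue _ ⟨b, hb1⟩, ?_⟩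
    rw [Valuation.HasExtension.algebraMap_residue_eq_residue_algebraMap, eq_comm,
      residue_eq_residue_iff]
    exact hb

theorem isPurelyWild_restrictTo_iff (p : ℕ) [Fact p.Prime]
    [CharP (ResidueField v.valuationSubring) p] [Algebra.IsAlgebraic K Ω]
    (M : IntermediateField K Ω) :
    IsPurelyWild p v (restrictTo w M) ↔
      ∀ x ∈ M, (x ≠ 0 → ∃ (k : ℕ) (b : K), w x ^ p ^ k = w (algebraMap K Ω b)) ∧
        (w x ≤ 1 → ∃ (k : ℕ) (b : K), w (x ^ p ^ k - algebraMap K Ω b) < 1) := by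
  constructor
  · intro h x hx
    refine ⟨fun hx0 => h.valueGroup_isPGroup ⟨x, hx⟩
      (fun h0 => hx0 (congrArg Subtype.val h0)), fun hwx => ?_⟩
    have h1 := h.residueField_isPurelyInseparable
    rw [isPurelyInseparable_iff_pow_mem _ p] at h1
    obtain ⟨k, hk⟩ := h1 (residue _ (⟨⟨x, hx⟩, hwx⟩ : (restrictTo w M).valuationSubring))
    rw [← map_pow, residue_mem_range_iff] at hk
    exact ⟨k, hk⟩
  · intro h
    refine ⟨inferInstance, fun x hx => (h x x.2).1 (by simpa using hx), ?_⟩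
    rw [isPurelyInseparable_iff_pow_mem _ p]
    intro z
    obtain ⟨x, rfl⟩ := residue_surjective z
    obtain ⟨k, hk⟩ := (h ((x : M) : Ω) x.1.2).2 x.2
    refine ⟨k, ?_⟩
    rw [← map_pow, residue_mem_range_iff]
    exact hk

theorem isImmediate_restrictTo_iff (M : IntermediateField K Ω) :
    IsImmediate v (restrictTo w M) ↔
      ∀ x ∈ M, (x ≠ 0 → ∃ b : K, w x = w (algebraMap K Ω b)) ∧
        (w x ≤ 1 → ∃ b : K, w (x - algebraMap K Ω b) < 1) := by
  constructor
  · intro h x hx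
    refine ⟨fun hx0 => h.valueGroup_eq ⟨x, hx⟩
      (fun h0 => hx0 (congrArg Subtype.val h0)), fun hwx => ?_⟩
    have h1 := h.residueField_eq
      (residue _ (⟨⟨x, hx⟩, hwx⟩ : (restrictTo w M).valuationSubring))
    exact (residue_mem_range_iff v (restrictTo w M) _).mp h1
  · intro h
    refine ⟨fun x hx => (h x x.2).1 (by simpa using hx), fun z => ?_⟩
    obtain ⟨x, rfl⟩ := residue_surjective z
    exact (residue_mem_range_iff v (restrictTo w M) x).mpr ((h ((x : M) : Ω) x.1.2).2 x.2)

end Residues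

/-! ### Maximal intermediate fields with an elementwise property -/

section Maximal

variable {K Ω : Type*} [Field K] [Field Ω] [Algebra K Ω]

/-- A property of intermediate fields that can be tested on their elements passes to unions of
chains, so Zorn's lemma applies. -/
theorem exists_le_maximal_of_forall_mem (T : Ω → Prop) (M : IntermediateField K Ω)
    (hM : ∀ x ∈ M, T x) :
    ∃ W, M ≤ W ∧ Maximal (fun W : IntermediateField K Ω => ∀ x ∈ W, T x) W := by
  refine zorn_le_nonempty₀ {W : IntermediateField K Ω | ∀ x ∈ W, T x}
    (fun c hc hchain W hW => ?_) M hM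
  refine ⟨sSup c, fun x hx => ?_, fun N hN => le_sSup hN⟩
  have : Nonempty c := ⟨⟨W, hW⟩⟩
  have hdir : Directed (· ≤ ·) (fun N : c => (N : IntermediateField K Ω)) :=
    hchain.directedOn.directed_val
  rw [sSup_eq_iSup', ← SetLike.mem_coe, IntermediateField.coe_iSup_of_directed hdir,
    Set.mem_iUnion] at hx
  obtain ⟨N, hN⟩ := hx
  exact hc N.2 x hN

end Maximal

/-! ### Lifting separable residues -/

section Lifting

variable {K Ω Γ₀ Γ₁ : Type*} [Field K] [Field Ω] [Algebra K Ω]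
  [LinearOrderedCommGroupWithZero Γ₀] [LinearOrderedCommGroupWithZero Γ₁]
  (v : Valuation K Γ₀) (w : Valuation Ω Γ₁) [v.HasExtension w]

theorem mem_of_forall_algEquiv_eq [IsGalois K Ω] (F : IntermediateField K Ω) {x : Ω}
    (h : ∀ σ : Gal(Ω/K), (∀ z ∈ F, σ z = z) → σ x = x) : x ∈ F := by
  rw [← InfiniteGalois.fixedField_fixingSubgroup F, IntermediateField.mem_fixedField_iff]
  intro σ hσ
  exact h σ fun z hz => (IntermediateField.mem_fixingSubgroup_iff F σ).mp hσ z hz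

theorem exists_root_val_sub_lt_one [IsAlgClosed Ω] (q : w.valuationSubring[X]) (hq : q.Monic)
    (x : w.valuationSubring) (hx : w (q.eval x : w.valuationSubring) < 1) :
    ∃ y : w.valuationSubring, q.eval y = 0 ∧ w ((x : Ω) - y) < 1 := by
  let Q : Polynomial Ω := q.map (algebraMap w.valuationSubring Ω)
  have hQ : Q.Monic := hq.map _
  have hsplit : Q = (Q.roots.map fun r => X - C r).prod := by
    have := (IsAlgClosed.splits Q).eq_prod_roots
    rwa [hQ.leadingCoeff, C_1, one_mul] at this
  have heval : (Q.eval (x : Ω)) = (q.eval x : w.valuationSubring) := by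
    rw [eval_map]
    exact eval₂_at_apply (algebraMap w.valuationSubring Ω) x
  obtain ⟨r, hr, hlt⟩ : ∃ r ∈ Q.roots, w ((x : Ω) - r) < 1 := by
    by_contra! hcon
    rw [← heval, hsplit, eval_multiset_prod, map_multiset_prod, Multiset.map_map,
      Multiset.map_map] at hx
    refine hx.not_ge (Multiset.one_le_prod fun a ha => ?_)
    obtain ⟨r, hr, rfl⟩ := Multiset.mem_map.mp ha
    simpa using hcon r hr
  have hr1 : w r ≤ 1 := by
    have : r = x - (x - r) := by ring
    rw [this]
    exact (w.map_sub _ _).trans (max_le x.2 hlt.le)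
  refine ⟨⟨r, hr1⟩, ?_, hlt⟩
  have h0 := (mem_roots'.mp hr).2.eq_zero
  rw [eval_map] at h0
  have h1 := eval₂_at_apply (p := q) (algebraMap w.valuationSubring Ω) ⟨r, hr1⟩
  exact Subtype.ext (h1.symm.trans h0)

/-- A separable element `z` of the residue field lifts to a root `ζ` of a monic polynomial over `K`
of the same degree. As `z` is a simple root of the reduction, no other conjugate of `ζ` has residue
`z`. -/
theorem exists_lift_of_isSeparable [IsAlgClosed Ω] {z : ResidueField w.valuationSubring}
    (hz : IsSeparable (ResidueField v.valuationSubring) z) :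
    ∃ (q : K[X]) (ζ : w.valuationSubring), q.Monic ∧
      q.natDegree = (minpoly (ResidueField v.valuationSubring) z).natDegree ∧
      aeval (ζ : Ω) q = 0 ∧ residue w.valuationSubring ζ = z ∧
      ∀ σ : Gal(Ω/K), w (σ ζ - ζ) < 1 → σ ζ = ζ := by
  have hmem : minpoly (ResidueField v.valuationSubring) z ∈
      lifts (residue v.valuationSubring) := by
    rw [lifts_iff_coeff_lifts]
    intro n
    exact residue_surjective _
  obtain ⟨q, hq, hqdeg, hqm⟩ := lifts_and_natDegree_eq_and_monic hmem (minpoly.monic hz.isIntegral)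
  let Q : w.valuationSubring[X] := q.map (algebraMap v.valuationSubring w.valuationSubring)
  have hQ : Q.map (residue w.valuationSubring) = (minpoly (ResidueField v.valuationSubring) z).map
      (algebraMap _ (ResidueField w.valuationSubring)) := by
    rw [← hq, Polynomial.map_map, Polynomial.map_map]
    rfl
  have hQΩ : Q.map (algebraMap w.valuationSubring Ω) =
      (q.map (algebraMap v.valuationSubring K)).map (algebraMap K Ω) := by
    rw [Polynomial.map_map, Polynomial.map_map]
    rfl
  have hres (f : w.valuationSubring[X]) (x : w.valuationSubring) :
      residue _ (f.eval x) = (f.map (residue w.valuationSubring)).eval (residue _ x) := by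
    rw [eval_map, eval₂_at_apply]
  obtain ⟨x, hx⟩ := residue_surjective z
  obtain ⟨ζ, hζ, hlt⟩ := exists_root_val_sub_lt_one w Q (hqm.map _) x (by
    rw [← Valuation.mem_maximalIdeal_iff, ← residue_eq_zero_iff, hres, hx, hQ, eval_map_algebraMap,
      minpoly.aeval])
  have hζz : residue w.valuationSubring ζ = z := by
    rw [← hx, eq_comm, residue_eq_residue_iff]
    exact hlt
  have haev : aeval (ζ : Ω) (q.map (algebraMap v.valuationSubring K)) = 0 := by
    rw [← eval_map_algebraMap, ← hQΩ, eval_map]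
    exact (eval₂_at_apply (algebraMap w.valuationSubring Ω) ζ).trans (by rw [hζ, map_zero])
  refine ⟨q.map (algebraMap v.valuationSubring K), ζ, hqm.map _, ?_, haev, hζz, fun σ hσ => ?_⟩
  · rw [hqm.natDegree_map, hqdeg]
  have hσ1 : w (σ ζ) ≤ 1 := by
    have : σ ζ = (σ ζ - ζ) + ζ := by ring
    rw [this]
    exact (w.map_add _ _).trans (max_le hσ.le ζ.2)
  have hσ0 : Q.eval ⟨σ ζ, hσ1⟩ = 0 := by
    have h1 := aeval_algHom_apply σ.toAlgHom (ζ : Ω) (q.map (algebraMap v.valuationSubring K))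
    rw [haev, map_zero, ← eval_map_algebraMap, ← hQΩ, eval_map] at h1
    have h2 := eval₂_at_apply (p := Q) (algebraMap w.valuationSubring Ω) ⟨σ ζ, hσ1⟩
    exact Subtype.ext (h2.symm.trans h1)
  have heq : ζ = ⟨σ ζ, hσ1⟩ := by
    refine eq_of_eval_eq_zero_of_not_isUnit_sub hζ hσ0 ?_ ?_
    · rw [← mem_nonunits_iff, ← mem_maximalIdeal, ← residue_eq_zero_iff, map_sub, sub_eq_zero,
        eq_comm, residue_eq_residue_iff]
      exact hσ
    · rw [← notMem_maximalIdeal, ← residue_eq_zero_iff, hres, ← derivative_map, hQ, derivative_map,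
        hζz, eval_map_algebraMap]
      exact hz.aeval_derivative_ne_zero (minpoly.aeval _ _)
  exact (congrArg Subtype.val heq).symm

end Lifting

/-! ### Valuation bases of unramified extensions -/

section UnramifiedTransfer

/-- The powers `1, z, …, z ^ (d - 1)` of a separable element of degree `d` remain linearly
independent over purely inseparable elements: after raising to a power `p ^ N` the relation has
coefficients in `F`, and `z ^ p ^ N` still has degree `d`. -/
theorem eq_zero_of_sum_mul_pow_eq_zero {F M : Type*} [Field F] [Field M] [Algebra F M] (p : ℕ)
    [Fact p.Prime] [CharP F p] {z : M} (hz : IsSeparable F z) {e : ℕ → M}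
    (he : ∀ i, ∃ m : ℕ, e i ^ p ^ m ∈ (algebraMap F M).range)
    (h0 : ∑ i ∈ Finset.range (minpoly F z).natDegree, e i * z ^ i = 0) {i : ℕ}
    (hi : i < (minpoly F z).natDegree) : e i = 0 := by
  have : CharP M p := charP_of_injective_algebraMap (algebraMap F M).injective p
  set d := (minpoly F z).natDegree with hd
  choose m hm using he
  let N := (Finset.range d).sup m
  have hN (j : ℕ) (hj : j ∈ Finset.range d) : ∃ b : F, algebraMap F M b = e j ^ p ^ N := by
    obtain ⟨b, hb⟩ := hm j
    obtain ⟨t, ht⟩ := Nat.exists_eq_add_of_le (Finset.le_sup (f := m) hj)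
    refine ⟨b ^ p ^ t, ?_⟩
    rw [map_pow, hb, ← pow_mul, ← pow_add, ← ht]
  choose! b hb using hN
  let f : F[X] := ∑ j ∈ Finset.range d, C (b j) * X ^ j
  have hf : aeval (z ^ p ^ N) f = 0 := by
    have h1 := congrArg (fun x : M => x ^ p ^ N) h0
    rw [sum_pow_char_pow, zero_pow (pow_ne_zero _ (NeZero.ne p))] at h1
    rw [← h1]
    simp only [f, map_sum, map_mul, aeval_C, map_pow, aeval_X]
    refine Finset.sum_congr rfl fun j hj => ?_
    rw [hb j hj, mul_pow, ← pow_mul, ← pow_mul, mul_comm j]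
  have hint : IsIntegral F z := hz.isIntegral
  have hdeg : (minpoly F (z ^ p ^ N)).natDegree = d := by
    rw [← IntermediateField.adjoin.finrank (hint.pow _),
      ← IntermediateField.adjoin_simple_eq_adjoin_pow_expChar_pow_of_isSeparable F M hz p N,
      IntermediateField.adjoin.finrank hint]
  have hfd : f.degree < d := by
    rw [degree_lt_iff_coeff_zero]
    intro j hj
    simp [f, coeff_C_mul, coeff_X_pow, Nat.not_lt.mpr hj]
  have hf0 : f = 0 := by
    by_contra hne
    have h1 := minpoly.degree_le_of_ne_zero F (z ^ p ^ N) hne hf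
    rw [degree_eq_natDegree (minpoly.ne_zero (hint.pow _)), hdeg] at h1
    exact hfd.not_ge h1
  have hbi : b i = 0 := by
    have := congrArg (fun g : F[X] => g.coeff i) hf0
    simpa [f, coeff_C_mul, coeff_X_pow, hi] using this
  have h1 := hb i (Finset.mem_range.mpr hi)
  rw [hbi, map_zero] at h1
  exact eq_zero_of_pow_eq_zero h1.symm

theorem exists_eq_sum_of_mem_sup {K Ω : Type*} [Field K] [Field Ω] [Algebra K Ω]
    {E : IntermediateField K Ω} {η : Ω} {q : K[X]} (hq : q.Monic) (hη : aeval η q = 0) {y : Ω}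
    (hy : y ∈ E ⊔ K⟮η⟯) :
    ∃ c : ℕ → Ω, (∀ i, c i ∈ E) ∧ y = ∑ i ∈ Finset.range q.natDegree, c i * η ^ i := by
  have hint : IsIntegral E η := IsIntegral.tower_top (R := K) ⟨q, hq, hη⟩
  rw [← IntermediateField.restrictScalars_adjoin_eq_sup, IntermediateField.mem_restrictScalars,
    ← IntermediateField.mem_toSubalgebra,
    IntermediateField.adjoin_simple_toSubalgebra_of_isAlgebraic hint.isAlgebraic,
    Algebra.adjoin_singleton_eq_range_aeval] at hy
  obtain ⟨f, rfl⟩ := hy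
  have hqE : (q.map (algebraMap K E)).Monic := hq.map _
  have hηE : aeval η (q.map (algebraMap K E)) = 0 := by rwa [aeval_map_algebraMap]
  have hmod := aeval_modByMonic_eq_self_of_root (p := f) hηE
  have hlt : (f %ₘ q.map (algebraMap K E)).degree < q.natDegree := by
    have := degree_modByMonic_lt f hqE
    rwa [degree_eq_natDegree hqE.ne_zero, hq.natDegree_map] at this
  refine ⟨fun i => ((f %ₘ q.map (algebraMap K E)).coeff i : E), fun i => SetLike.coe_mem _, ?_⟩
  change aeval η f = _
  rw [← hmod, aeval_def, eval₂_eq_sum_range' _ (n := q.natDegree) ?_ η]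
  · rfl
  · rcases eq_or_ne (f %ₘ q.map (algebraMap K E)) 0 with h0 | h0
    · rw [h0, natDegree_zero]
      by_contra! hle
      rw [h0, degree_zero, Nat.le_zero.mp hle] at hlt
      have := hq.natDegree_eq_zero.mp (Nat.le_zero.mp hle)
      rw [this] at hη
      simp at hη
    · exact (natDegree_lt_iff_degree_lt h0).mpr hlt

variable {K Ω Γ₀ Γ₁ : Type*} [Field K] [Field Ω] [Algebra K Ω]
  [LinearOrderedCommGroupWithZero Γ₀] [LinearOrderedCommGroupWithZero Γ₁]
  (v : Valuation K Γ₀) (w : Valuation Ω Γ₁) [v.HasExtension w]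
  (p : ℕ) [Fact p.Prime] [CharP (ResidueField v.valuationSubring) p]

/-- If `E` has purely inseparable residues and `η` has a separable residue of degree `d`, then
`1, η, …, η ^ (d - 1)` is a valuation basis over `E`: the value of a combination is the maximum of
the values of its coefficients. -/
theorem exists_val_sum_eq {E : IntermediateField K Ω}
    (hE : ∀ x ∈ E, w x ≤ 1 → ∃ (m : ℕ) (b : K), w (x ^ p ^ m - algebraMap K Ω b) < 1)
    {η : w.valuationSubring}
    (hη : IsSeparable (ResidueField v.valuationSubring) (residue w.valuationSubring η))
    {c : ℕ → Ω} (hc : ∀ i, c i ∈ E) {d : ℕ}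
    (hd : d = (minpoly (ResidueField v.valuationSubring) (residue w.valuationSubring η)).natDegree)
    (hc0 : ∃ i < d, c i ≠ 0) :
    ∃ i < d, c i ≠ 0 ∧ w (∑ j ∈ Finset.range d, c j * (η : Ω) ^ j) = w (c i) ∧
      ∀ j < d, w (c j) ≤ w (c i) := by
  obtain ⟨i₀, hi₀, hci₀⟩ := hc0
  obtain ⟨i, hi, hmax⟩ := Finset.exists_max_image (Finset.range d) (fun i => w (c i))
    ⟨i₀, Finset.mem_range.mpr hi₀⟩
  have hci : c i ≠ 0 := by
    intro h
    have h1 := hmax i₀ (Finset.mem_range.mpr hi₀)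
    rw [h, map_zero, le_zero_iff, map_eq_zero] at h1
    exact hci₀ h1
  have hwci : w (c i) ≠ 0 := by simpa using hci
  refine ⟨i, Finset.mem_range.mp hi, hci, ?_, fun j hj => hmax j (Finset.mem_range.mpr hj)⟩
  have hle (j : ℕ) : w (if j < d then c j / c i else 0) ≤ 1 := by
    split_ifs with hj
    · rw [map_div₀]
      exact div_le_one_of_le₀ (hmax j (Finset.mem_range.mpr hj)) zero_le
    · simp
  -- Division by a coefficient of maximal value makes all coefficients integral, one equal to `1`.
  let e : ℕ → w.valuationSubring := fun j => ⟨if j < d then c j / c i else 0, hle j⟩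
  have he (j : ℕ) : ∃ m : ℕ, residue w.valuationSubring (e j) ^ p ^ m ∈
      (algebraMap (ResidueField v.valuationSubring) (ResidueField w.valuationSubring)).range := by
    obtain ⟨m, hm⟩ := hE (e j) (by
      change (if j < d then c j / c i else 0) ∈ E
      split_ifs
      · exact E.div_mem (hc j) (hc i)
      · exact E.zero_mem) (e j).2
    refine ⟨m, ?_⟩
    rw [← map_pow, residue_mem_range_iff]
    exact hm
  let s : w.valuationSubring := ∑ j ∈ Finset.range d, e j * η ^ j
  have hs : ∑ j ∈ Finset.range d, c j * (η : Ω) ^ j = c i * (s : Ω) := by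
    have : (s : Ω) = ∑ j ∈ Finset.range d, (e j : Ω) * (η : Ω) ^ j := by
      simp [s]
    rw [this, Finset.mul_sum]
    refine Finset.sum_congr rfl fun j hj => ?_
    have : (e j : Ω) = c j / c i := if_pos (Finset.mem_range.mp hj)
    rw [this]
    field_simp
  have hs1 : w (s : Ω) = 1 := by
    refine le_antisymm s.2 (not_lt.mp fun hlt => ?_)
    rw [← Valuation.mem_maximalIdeal_iff, ← residue_eq_zero_iff, map_sum] at hlt
    simp only [map_mul, map_pow, hd] at hlt
    have h1 := eq_zero_of_sum_mul_pow_eq_zero p hη he hlt (hd ▸ Finset.mem_range.mp hi)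
    have h2 : e i = 1 := Subtype.ext ((if_pos (Finset.mem_range.mp hi)).trans (div_self hci))
    rw [h2, map_one] at h1
    exact one_ne_zero h1
  rw [hs, map_mul, hs1, mul_one]

variable {E E' : IntermediateField K Ω}

theorem exists_val_eq_and_eq_sum
    (hE : ∀ x ∈ E, w x ≤ 1 → ∃ (m : ℕ) (b : K), w (x ^ p ^ m - algebraMap K Ω b) < 1)
    {η : w.valuationSubring}
    (hη : IsSeparable (ResidueField v.valuationSubring) (residue w.valuationSubring η))
    {q : K[X]} (hq : q.Monic) (hqη : aeval (η : Ω) q = 0) (hqd : q.natDegree =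
      (minpoly (ResidueField v.valuationSubring) (residue w.valuationSubring η)).natDegree)
    {y : Ω} (hy : y ∈ E ⊔ K⟮(η : Ω)⟯) :
    ∃ c : ℕ → Ω, (∀ i, c i ∈ E) ∧ y = ∑ i ∈ Finset.range q.natDegree, c i * (η : Ω) ^ i ∧
      (∀ i < q.natDegree, w (c i) ≤ w y) ∧ ∃ e ∈ E, w y = w e := by
  obtain ⟨c, hc, rfl⟩ := exists_eq_sum_of_mem_sup hq hqη hy
  refine ⟨c, hc, rfl, ?_⟩
  by_cases h0 : ∃ i < q.natDegree, c i ≠ 0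
  · obtain ⟨i, -, -, h1, h2⟩ := exists_val_sum_eq v w p hE hη hc hqd h0
    rw [h1]
    exact ⟨h2, c i, hc i, rfl⟩
  · push Not at h0
    refine ⟨fun i hi => by simp [h0 i hi], 0, E.zero_mem, ?_⟩
    rw [Finset.sum_eq_zero fun i hi => by rw [h0 i (Finset.mem_range.mp hi), zero_mul]]

/-- The residue degree of `η` over `K` is a lower bound for the degree of `η` over `E`. -/
theorem mul_natDegree_le_finrank_sup [Algebra.IsAlgebraic K Ω]
    (hE : ∀ x ∈ E, w x ≤ 1 → ∃ (m : ℕ) (b : K), w (x ^ p ^ m - algebraMap K Ω b) < 1)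
    {η : w.valuationSubring}
    (hη : IsSeparable (ResidueField v.valuationSubring) (residue w.valuationSubring η)) :
    Module.finrank K E *
      (minpoly (ResidueField v.valuationSubring) (residue w.valuationSubring η)).natDegree ≤
      Module.finrank K ↥(E ⊔ K⟮(η : Ω)⟯) := by
  set d := (minpoly (ResidueField v.valuationSubring) (residue w.valuationSubring η)).natDegree
    with hd
  have hint : IsIntegral E (η : Ω) :=
    (Algebra.IsIntegral.isIntegral (R := K) (η : Ω)).tower_top
  have h1 : Module.finrank K ↥(E ⊔ K⟮(η : Ω)⟯) =
      Module.finrank K E * (minpoly E (η : Ω)).natDegree := by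
    rw [← IntermediateField.restrictScalars_adjoin_eq_sup, ← IntermediateField.adjoin.finrank hint]
    exact (Module.finrank_mul_finrank K E E⟮(η : Ω)⟯).symm
  rw [h1]
  refine Nat.mul_le_mul_left _ (not_lt.mp fun hlt => ?_)
  let f := minpoly E (η : Ω)
  obtain ⟨i, hi, hi0, h2, -⟩ := exists_val_sum_eq v w p hE hη (c := fun i => (f.coeff i : Ω))
    (fun i => SetLike.coe_mem _) hd ⟨f.natDegree, hlt, by
      change ((f.leadingCoeff : E) : Ω) ≠ 0
      rw [minpoly.monic hint]
      simp⟩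
  have h3 := minpoly.aeval E (η : Ω)
  rw [aeval_def, eval₂_eq_sum_range' _ hlt] at h3
  have h4 : ∑ j ∈ Finset.range d, (f.coeff j : Ω) * (η : Ω) ^ j = 0 := h3
  rw [h4, map_zero, eq_comm, map_eq_zero] at h2
  exact hi0 h2

end UnramifiedTransfer

/-! ### Descent of residues along an unramified extension -/

section Descent

/-- If `A ⊔ B` has the largest degree that bounds on the degrees of `A` and `B` permit, then `A` and
`B` have no common subfield other than `K`. -/
theorem eq_bot_of_le_of_le_of_finrank_sup {K Ω : Type*} [Field K] [Field Ω] [Algebra K Ω]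
    {A B Z : IntermediateField K Ω} (hZA : Z ≤ A) (hZB : Z ≤ B) {m d : ℕ}
    (hA : Module.finrank K A ≤ m) (hB : Module.finrank K B ≤ d)
    (h : m * d ≤ Module.finrank K ↥(A ⊔ B)) (hpos : 0 < m * d) : Z = ⊥ := by
  have h1 := IntermediateField.finrank_bot_mul_relfinrank hZA
  have h2 := IntermediateField.finrank_bot_mul_relfinrank hZB
  have h3 := IntermediateField.finrank_bot_mul_relfinrank (hZA.trans (le_sup_left (b := B)))
  have h4 : Z.relfinrank (A ⊔ B) ≤ Z.relfinrank A * Z.relfinrank B := by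
    rw [IntermediateField.relfinrank_eq_finrank_of_le hZA,
      IntermediateField.relfinrank_eq_finrank_of_le hZB,
      IntermediateField.relfinrank_eq_finrank_of_le (hZA.trans le_sup_left),
      ← IntermediateField.extendScalars_sup hZA hZB]
    exact IntermediateField.finrank_sup_le _ _
  rw [← IntermediateField.finrank_eq_one_iff]
  set e := Module.finrank K Z
  have he : 0 < e := by
    rcases Nat.eq_zero_or_pos e with h0 | h0
    · rw [h0, zero_mul] at h3
      lia
    · exact h0
  -- With `e = [Z : K]`, the degrees give `m * d ≤ e * (m / e) * (d / e)`.
  have h5 : e * (m * d) ≤ 1 * (m * d) :=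
    calc e * (m * d) ≤ e * (e * (Z.relfinrank A * Z.relfinrank B)) := by
          refine Nat.mul_le_mul_left _ (h.trans ?_)
          rw [← h3]
          exact Nat.mul_le_mul_left _ h4
      _ = (e * Z.relfinrank A) * (e * Z.relfinrank B) := by ring
      _ ≤ m * d := by
          rw [h1, h2]
          exact Nat.mul_le_mul hA hB
      _ = 1 * (m * d) := (one_mul _).symm
  have := Nat.le_of_mul_le_mul_right h5 hpos
  lia

/-- Krasner's lemma: an element that differs by at least `1` in value from all its other conjugates
lies in every intermediate field that approximates it to within value `< 1`. -/
theorem mem_of_forall_val_sub_lt_one {K Ω Γ₀ Γ₁ : Type*} [Field K] [CharZero K] [Field Ω]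
    [Algebra K Ω] [IsAlgClosure K Ω] [LinearOrderedCommGroupWithZero Γ₀]
    [LinearOrderedCommGroupWithZero Γ₁] (v : Valuation K Γ₀) [HenselianLocalRing v.valuationSubring]
    (w : Valuation Ω Γ₁) [v.HasExtension w] {ζ : Ω}
    (hζ : ∀ σ : Gal(Ω/K), w (σ ζ - ζ) < 1 → σ ζ = ζ) {F : IntermediateField K Ω} {s : Ω}
    (hs : s ∈ F) (hsζ : w (ζ - s) < 1) : ζ ∈ F := by
  have : IsAlgClosed Ω := IsAlgClosure.isAlgClosed K
  have : Algebra.IsAlgebraic K Ω := IsAlgClosure.isAlgebraic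
  have : Normal K Ω := IsAlgClosure.normal K Ω
  have : IsGalois K Ω := ⟨⟩
  refine mem_of_forall_algEquiv_eq F fun σ hσ => hζ σ ?_
  have h1 : σ ζ - ζ = σ (ζ - s) - (ζ - s) := by
    rw [map_sub, hσ s hs]
    ring
  rw [h1]
  exact (w.map_sub _ _).trans_lt (max_lt (val_algEquiv_lt_one v w σ hsζ) hsζ)

variable {K Ω Γ₀ Γ₁ : Type*} [Field K] [CharZero K] [Field Ω] [Algebra K Ω] [IsAlgClosure K Ω]
  [LinearOrderedCommGroupWithZero Γ₀] [LinearOrderedCommGroupWithZero Γ₁]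
  (v : Valuation K Γ₀) [HenselianLocalRing v.valuationSubring]
  (w : Valuation Ω Γ₁) [v.HasExtension w]
  (p : ℕ) [Fact p.Prime] [CharP (ResidueField v.valuationSubring) p]

variable {E E' : IntermediateField K Ω} [FiniteDimensional K E]

/-- If `E` and `E'` become equal after adjoining `η`, and the degree of `E'` is at most that of `E`,
then a residue of `E'` that is generated by the residue of `η` comes from `K`: it lifts to an
element of both `E'` and `K(η)`, fields that have only `K` in common. -/
theorem exists_val_sub_lt_one_of_mem_of_aeval
    (hE : ∀ x ∈ E, w x ≤ 1 → ∃ (m : ℕ) (b : K), w (x ^ p ^ m - algebraMap K Ω b) < 1)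
    {η : w.valuationSubring}
    (hη : IsSeparable (ResidueField v.valuationSubring) (residue w.valuationSubring η))
    {q : K[X]} (hq : q.Monic) (hqη : aeval (η : Ω) q = 0) (hqd : q.natDegree =
      (minpoly (ResidueField v.valuationSubring) (residue w.valuationSubring η)).natDegree)
    (hdeg : Module.finrank K E' ≤ Module.finrank K E)
    (hsup : E ⊔ K⟮(η : Ω)⟯ = E' ⊔ K⟮(η : Ω)⟯)
    {y : w.valuationSubring} (hy : (y : Ω) ∈ E') {f : v.valuationSubring[X]}
    (hf : residue w.valuationSubring y = aeval (residue w.valuationSubring η)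
      (f.map (residue v.valuationSubring))) :
    ∃ b : K, w (y - algebraMap K Ω b) < 1 := by
  have : IsAlgClosed Ω := IsAlgClosure.isAlgClosed K
  have : Algebra.IsAlgebraic K Ω := IsAlgClosure.isAlgebraic
  have hsep : IsSeparable (ResidueField v.valuationSubring) (residue w.valuationSubring y) := by
    have h1 := (IntermediateField.isSeparable_adjoin_simple_iff_isSeparable _ _).mpr hη
    have h2 : residue w.valuationSubring y ∈
        (ResidueField v.valuationSubring)⟮residue w.valuationSubring η⟯ := by
      rw [hf]
      exact IntermediateField.algebra_adjoin_le_adjoin _ _ (aeval_mem_adjoin_singleton _ _)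
    exact IntermediateField.isSeparable_of_mem_isSeparable _ _ h2
  obtain ⟨-, ζ, -, -, -, hζ, hσ⟩ := exists_lift_of_isSeparable v w hsep
  have hζy : w (ζ - (y : Ω)) < 1 := (residue_eq_residue_iff ζ y).mp hζ
  let s : w.valuationSubring := aeval η f
  have hs : residue w.valuationSubring ζ = residue w.valuationSubring s := by
    rw [hζ, hf, aeval_def, eval₂_map]
    exact (hom_eval₂ f _ (residue w.valuationSubring) η).symm
  have hsη : (s : Ω) ∈ K⟮(η : Ω)⟯ := by
    have h1 : (s : Ω) = aeval (η : Ω) (f.map (algebraMap v.valuationSubring K)) := by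
      rw [aeval_def, eval₂_map]
      exact hom_eval₂ f _ (algebraMap w.valuationSubring Ω) η
    rw [h1]
    exact IntermediateField.algebra_adjoin_le_adjoin _ _ (aeval_mem_adjoin_singleton _ _)
  have h1 : (ζ : Ω) ∈ E' := mem_of_forall_val_sub_lt_one v w hσ hy hζy
  have h2 : (ζ : Ω) ∈ K⟮(η : Ω)⟯ :=
    mem_of_forall_val_sub_lt_one v w hσ hsη ((residue_eq_residue_iff ζ s).mp hs)
  have hηK : Module.finrank K K⟮(η : Ω)⟯ ≤ (minpoly (ResidueField v.valuationSubring)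
      (residue w.valuationSubring η)).natDegree := by
    rw [IntermediateField.adjoin.finrank ⟨q, hq, hqη⟩, ← hqd]
    exact natDegree_le_of_dvd (minpoly.dvd K _ hqη) hq.ne_zero
  have hbot := eq_bot_of_le_of_le_of_finrank_sup (Z := K⟮(ζ : Ω)⟯)
    (IntermediateField.adjoin_simple_le_iff.mpr h1) (IntermediateField.adjoin_simple_le_iff.mpr h2)
    hdeg hηK (hsup ▸ mul_natDegree_le_finrank_sup v w p hE hη)
    (Nat.mul_pos Module.finrank_pos (minpoly.natDegree_pos hη.isIntegral))
  have h3 := IntermediateField.mem_adjoin_simple_self K (ζ : Ω)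
  rw [hbot, IntermediateField.mem_bot] at h3
  obtain ⟨b, hb⟩ := h3
  exact ⟨b, by rw [hb, Valuation.map_sub_swap]; exact hζy⟩

/-- If `E` and `E'` become equal after adjoining `η`, then any exponent `N` such that the `p ^ N`-th
powers of suitable finitely many residues of `E` come from `K` also works for a given residue of
`E'`. The finite set consists of the coefficients of `y` with respect to the powers of `η`. The case
`N = 0` is the one needed for immediate extensions. -/
theorem exists_pow_val_sub_lt_one_of_mem
    (hE : ∀ x ∈ E, w x ≤ 1 → ∃ (m : ℕ) (b : K), w (x ^ p ^ m - algebraMap K Ω b) < 1)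
    {η : w.valuationSubring}
    (hη : IsSeparable (ResidueField v.valuationSubring) (residue w.valuationSubring η))
    {q : K[X]} (hq : q.Monic) (hqη : aeval (η : Ω) q = 0) (hqd : q.natDegree =
      (minpoly (ResidueField v.valuationSubring) (residue w.valuationSubring η)).natDegree)
    (hdeg : Module.finrank K E' ≤ Module.finrank K E)
    (hsup : E ⊔ K⟮(η : Ω)⟯ = E' ⊔ K⟮(η : Ω)⟯)
    {y : w.valuationSubring} (hy : (y : Ω) ∈ E') :
    ∃ I : Finset Ω, (∀ x ∈ I, x ∈ E ∧ w x ≤ 1) ∧ ∀ N : ℕ,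
      (∀ x ∈ I, ∃ b : K, w (x ^ p ^ N - algebraMap K Ω b) < 1) →
      ∃ b : K, w ((y : Ω) ^ p ^ N - algebraMap K Ω b) < 1 := by
  classical
  have : CharP (ResidueField w.valuationSubring) p := charP_of_injective_algebraMap
    (algebraMap (ResidueField v.valuationSubring) (ResidueField w.valuationSubring)).injective p
  obtain ⟨c, hcE, hyc, hcy, -⟩ := exists_val_eq_and_eq_sum v w p hE hη hq hqη hqd
    (y := (y : Ω)) (hsup ▸ le_sup_left (a := E') hy)
  set d := q.natDegree
  refine ⟨(Finset.range d).image c, ?_, fun N hN => ?_⟩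
  · intro x hx
    obtain ⟨i, hi, rfl⟩ := Finset.mem_image.mp hx
    exact ⟨hcE i, (hcy i (Finset.mem_range.mp hi)).trans y.2⟩
  have hc1 (i : ℕ) : w (if i < d then c i else 0) ≤ 1 := by
    split_ifs with hi
    · exact (hcy i hi).trans y.2
    · simp
  let e : ℕ → w.valuationSubring := fun i => ⟨_, hc1 i⟩
  have hye : y = ∑ i ∈ Finset.range d, e i * η ^ i := by
    refine Subtype.ext ?_
    rw [hyc]
    simp only [AddSubmonoidClass.coe_finsetSum, MulMemClass.coe_mul, SubmonoidClass.coe_pow]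
    exact Finset.sum_congr rfl fun i hi => by
      rw [show (e i : Ω) = c i from if_pos (Finset.mem_range.mp hi)]
  have hb (i : ℕ) (hi : i ∈ Finset.range d) : ∃ b : v.valuationSubring,
      algebraMap (ResidueField v.valuationSubring) (ResidueField w.valuationSubring)
        (residue v.valuationSubring b) = residue w.valuationSubring (e i) ^ p ^ N := by
    obtain ⟨b, hb⟩ := hN _ (Finset.mem_image_of_mem c hi)
    have h1 := (residue_mem_range_iff v w (e i ^ p ^ N)).mpr ⟨b, by
      simpa [e, Finset.mem_range.mp hi] using hb⟩
    obtain ⟨r, hr⟩ := h1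
    obtain ⟨b, rfl⟩ := residue_surjective r
    exact ⟨b, by rw [hr, map_pow]⟩
  choose! b hb using hb
  refine exists_val_sub_lt_one_of_mem_of_aeval v w p hE hη hq hqη hqd hdeg hsup (y := y ^ p ^ N)
    (f := ∑ i ∈ Finset.range d, C (b i) * X ^ (i * p ^ N)) (by simpa using pow_mem hy (p ^ N)) ?_
  rw [map_pow, hye, map_sum, sum_pow_char_pow]
  simp only [Polynomial.map_sum, Polynomial.map_mul, map_C, Polynomial.map_pow, map_X, map_sum,
    map_mul, aeval_C, map_pow, aeval_X]
  refine Finset.sum_congr rfl fun i hi => ?_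
  rw [hb i hi, mul_pow, ← pow_mul]

end Descent

/-! ### Translates of a root of an additive polynomial -/

section Translate

theorem derivative_additiveForm {R : Type*} [CommRing R] (p : ℕ) [CharP R p] (n : ℕ) (a : ℕ → R) :
    derivative (additiveForm p n a) = C (a 0) := by
  rw [additiveForm, Finset.sum_range_succ', derivative_add, derivative_sum,
    Finset.sum_eq_zero fun i _ => ?_]
  · simp
  · simp [derivative_X_pow, CharP.cast_eq_zero]

theorem isSeparable_of_aeval_additiveForm (p n : ℕ) {k M : Type*} [Field k] [Field M] [Algebra k M]
    [CharP k p] {a : ℕ → k} (ha₀ : a 0 ≠ 0) {z : M} {b : k}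
    (h : aeval z (additiveForm p n a) = algebraMap k M b) : IsSeparable k z := by
  have hsep : (additiveForm p n a - C b).Separable := by
    rw [separable_def, derivative_sub, derivative_additiveForm, derivative_C, sub_zero]
    exact (isCoprime_one_right (x := additiveForm p n a - C b)).of_isCoprime_of_dvd_right
      ((isUnit_C.mpr (isUnit_iff_ne_zero.mpr ha₀)).dvd)
  exact hsep.of_dvd (minpoly.dvd k z (by rw [map_sub, aeval_C, h, sub_self]))

theorem val_residueChar_lt_one {K Ω Γ₀ Γ₁ : Type*} [Field K] [Field Ω] [Algebra K Ω]
    [LinearOrderedCommGroupWithZero Γ₀] [LinearOrderedCommGroupWithZero Γ₁] (v : Valuation K Γ₀)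
    (w : Valuation Ω Γ₁) [v.HasExtension w] (p : ℕ) [CharP (ResidueField v.valuationSubring) p] :
    w (p : Ω) < 1 := by
  have h : residue v.valuationSubring (p : v.valuationSubring) = 0 := by
    rw [map_natCast, CharP.cast_eq_zero]
  rw [residue_eq_zero_iff, Valuation.mem_maximalIdeal_iff,
    ← Valuation.HasExtension.val_map_lt_one_iff v w] at h
  simpa using h

variable {K Ω Γ₀ Γ₁ : Type*} [Field K] [Field Ω] [Algebra K Ω]
  [LinearOrderedCommGroupWithZero Γ₀] [LinearOrderedCommGroupWithZero Γ₁]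
  (v : Valuation K Γ₀) (w : Valuation Ω Γ₁) [v.HasExtension w]
  (p : ℕ) {n : ℕ} {a : ℕ → v.valuationSubring}

theorem aeval_map_additiveForm (x : Ω) :
    aeval x ((additiveForm p n a).map (algebraMap v.valuationSubring K)) =
      (additiveForm p n fun i => algebraMap K Ω (a i)).eval x := by
  rw [← eval_map_algebraMap, Polynomial.map_map, map_additiveForm]
  rfl

theorem val_coeff_le_one (i : ℕ) : w (algebraMap K Ω (a i)) ≤ 1 :=
  (Valuation.HasExtension.val_map_le_one_iff v w _).mpr (a i).2

theorem aeval_residue_eq_of_val_sub_lt_one {x : w.valuationSubring} {b : v.valuationSubring}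
    (h : w ((additiveForm p n fun i => algebraMap K Ω (a i)).eval (x : Ω) - algebraMap K Ω b) < 1) :
    aeval (residue w.valuationSubring x) ((additiveForm p n a).map (residue v.valuationSubring)) =
      algebraMap (ResidueField v.valuationSubring) (ResidueField w.valuationSubring)
        (residue v.valuationSubring b) := by
  let s : w.valuationSubring := aeval x (additiveForm p n a)
  have hs : (s : Ω) = (additiveForm p n fun i => algebraMap K Ω (a i)).eval (x : Ω) := by
    rw [← aeval_map_additiveForm, aeval_def, eval₂_map]
    exact hom_eval₂ (additiveForm p n a) _ (algebraMap w.valuationSubring Ω) x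
  have hs' : residue w.valuationSubring s = aeval (residue w.valuationSubring x)
      ((additiveForm p n a).map (residue v.valuationSubring)) := by
    rw [aeval_def, eval₂_map]
    exact hom_eval₂ (additiveForm p n a) _ (residue w.valuationSubring) x
  rw [← hs', Valuation.HasExtension.algebraMap_residue_eq_residue_algebraMap,
    residue_eq_residue_iff, hs]
  exact h

variable {v w p} [CharP (ResidueField v.valuationSubring) p]

/-- An approximate solution of `𝔄(x) = b` has a separable residue, because the derivative of the
reduction of `𝔄(X) - b` is the nonzero constant `a 0`. -/
theorem isSeparable_residue_of_val_sub_lt_one (ha₀ : v (a 0) = 1) {x : w.valuationSubring}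
    {b : v.valuationSubring}
    (h : w ((additiveForm p n fun i => algebraMap K Ω (a i)).eval (x : Ω) - algebraMap K Ω b) < 1) :
    IsSeparable (ResidueField v.valuationSubring) (residue w.valuationSubring x) := by
  have h1 := aeval_residue_eq_of_val_sub_lt_one v w p h
  rw [map_additiveForm] at h1
  refine isSeparable_of_aeval_additiveForm p n ?_ h1
  rw [ne_eq, residue_eq_zero_iff, Valuation.mem_maximalIdeal_iff]
  exact ha₀.not_lt

variable [hp : Fact p.Prime] {T x θ : Ω} {b : v.valuationSubring}

theorem val_le_one_of_eval_add_eq (haₙ : v (a n) = 1)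
    (hT : w T ^ p ^ n * w (p : Ω) < 1)
    (hx : (additiveForm p n fun i => algebraMap K Ω (a i)).eval (T + x) -
      (additiveForm p n fun i => algebraMap K Ω (a i)).eval T = algebraMap K Ω b) : w x ≤ 1 := by
  by_contra! hlt
  have h1 := one_lt_val_additiveForm_eval_add_sub (val_residueChar_lt_one v w p) hT
    (val_coeff_le_one v w) ((Valuation.HasExtension.val_map_eq_one_iff v w _).mpr haₙ) hlt
  rw [hx] at h1
  exact h1.not_ge ((Valuation.HasExtension.val_map_le_one_iff v w _).mpr b.2)

theorem val_eval_sub_lt_one_of_eval_add_eq (hT : w T ^ p ^ n * w (p : Ω) < 1) (hwx : w x ≤ 1)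
    (hx : (additiveForm p n fun i => algebraMap K Ω (a i)).eval (T + x) -
      (additiveForm p n fun i => algebraMap K Ω (a i)).eval T = algebraMap K Ω b) :
    w ((additiveForm p n fun i => algebraMap K Ω (a i)).eval x - algebraMap K Ω b) < 1 := by
  have h1 := val_additiveForm_eval_add_sub_lt_one (val_residueChar_lt_one v w p) hT
    (val_coeff_le_one v w (a := a)) hwx
  rwa [hx, Valuation.map_sub_swap] at h1

/-- A field with purely inseparable residues cannot contain two elements at which the values of the
additive polynomial differ by `b`, if the residue of `b` is not a value of the reduced polynomial:
the difference of the two elements has a separable residue, which would have to come from `K`. -/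
theorem false_of_mem_of_mem (ha₀ : v (a 0) = 1) (haₙ : v (a n) = 1)
    (hb : residue v.valuationSubring b ∉ Set.range
      fun y => ((additiveForm p n a).map (residue v.valuationSubring)).eval y)
    {W : IntermediateField K Ω}
    (hW : ∀ x ∈ W, w x ≤ 1 → ∃ (m : ℕ) (b : K), w (x ^ p ^ m - algebraMap K Ω b) < 1)
    {T T' : Ω} (hT : w T ^ p ^ n * w (p : Ω) < 1) (hTW : T ∈ W) (hTW' : T' ∈ W)
    (h : (additiveForm p n fun i => algebraMap K Ω (a i)).eval T' -
      (additiveForm p n fun i => algebraMap K Ω (a i)).eval T = algebraMap K Ω b) : False := by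
  have hx : (additiveForm p n fun i => algebraMap K Ω (a i)).eval (T + (T' - T)) -
      (additiveForm p n fun i => algebraMap K Ω (a i)).eval T = algebraMap K Ω b := by
    rwa [add_sub_cancel]
  have hwx := val_le_one_of_eval_add_eq haₙ hT hx
  have hlt := val_eval_sub_lt_one_of_eval_add_eq hT hwx hx
  let x : w.valuationSubring := ⟨T' - T, hwx⟩
  have hsep := isSeparable_residue_of_val_sub_lt_one ha₀ (x := x) hlt
  obtain ⟨m, hm⟩ := hW _ (W.sub_mem hTW' hTW) hwx
  have hmem : residue w.valuationSubring x ^ p ^ m ∈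
      (algebraMap (ResidueField v.valuationSubring) (ResidueField w.valuationSubring)).range := by
    rw [← map_pow, residue_mem_range_iff]
    exact hm
  have hadj := IntermediateField.adjoin_simple_eq_adjoin_pow_expChar_pow_of_isSeparable
    (ResidueField v.valuationSubring) (ResidueField w.valuationSubring) hsep p m
  have hz := IntermediateField.mem_adjoin_simple_self (ResidueField v.valuationSubring)
    (residue w.valuationSubring x)
  rw [hadj, IntermediateField.adjoin_simple_eq_bot_iff.mpr (IntermediateField.mem_bot.mpr hmem),
    IntermediateField.mem_bot] at hz
  obtain ⟨y, hy⟩ := hz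
  have h1 := aeval_residue_eq_of_val_sub_lt_one v w p (x := x) hlt
  rw [← hy, aeval_algebraMap_apply] at h1
  exact hb ⟨y, (algebraMap _ (ResidueField w.valuationSubring)).injective h1⟩

/-- Krasner's lemma for the roots `T` of `𝔄(X) - c`, which need not be integral. -/
theorem mem_of_val_sub_lt_one [CharZero K] [IsAlgClosure K Ω]
    [HenselianLocalRing v.valuationSubring] (ha₀ : v (a 0) = 1)
    (hT : w T ^ p ^ n * w (p : Ω) < 1) {c : K}
    (hc : aeval T ((additiveForm p n a).map (algebraMap v.valuationSubring K)) = algebraMap K Ω c)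
    {F : IntermediateField K Ω} {s : Ω} (hs : s ∈ F) (hsT : w (T - s) < 1) : T ∈ F := by
  refine mem_of_forall_val_sub_lt_one v w (fun σ hσ => ?_) hs hsT
  by_contra hne
  have h1 := val_additiveForm_eval_add_sub_eq (val_residueChar_lt_one v w p) hT
    (val_coeff_le_one v w (a := a)) ((Valuation.HasExtension.val_map_eq_one_iff v w _).mpr ha₀)
    (sub_ne_zero.mpr hne) hσ
  have h2 : aeval (σ T) ((additiveForm p n a).map (algebraMap v.valuationSubring K)) =
      algebraMap K Ω c := by
    rw [← σ.commutes c, ← hc]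
    exact aeval_algHom_apply σ.toAlgHom T _
  rw [add_sub_cancel, ← aeval_map_additiveForm, ← aeval_map_additiveForm, h2, hc, sub_self,
    map_zero, eq_comm, map_eq_zero, sub_eq_zero] at h1
  exact hne h1

/-- Nonuniqueness of the maximal extensions with an elementwise property `P` that forces the residue
field extension to be purely inseparable. A `K`-isomorphism would carry `θ'` to a root of
`𝔄(X) - (c + b)` in a field that contains `θ`. -/
theorem exists_maximal_not_algEquiv {c : K} (ha₀ : v (a 0) = 1) (haₙ : v (a n) = 1)
    {b : v.valuationSubring} (hb : residue v.valuationSubring b ∉ Set.range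
      fun y => ((additiveForm p n a).map (residue v.valuationSubring)).eval y)
    (hval : w θ ^ p ^ n * w (p : Ω) < 1)
    (hθ : aeval θ ((additiveForm p n a).map (algebraMap v.valuationSubring K)) = algebraMap K Ω c)
    {θ' : Ω} (hθ' : aeval θ' ((additiveForm p n a).map (algebraMap v.valuationSubring K)) =
      algebraMap K Ω (c + b)) (P : Ω → Prop)
    (hP : ∀ x, P x → w x ≤ 1 → ∃ (m : ℕ) (b : K), w (x ^ p ^ m - algebraMap K Ω b) < 1)
    (hPθ : ∀ x ∈ K⟮θ⟯, P x) (hPθ' : ∀ x ∈ K⟮θ'⟯, P x) :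
    ∃ W₁ W₂ : IntermediateField K Ω,
      Maximal (fun W : IntermediateField K Ω => ∀ x ∈ W, P x) W₁ ∧
      Maximal (fun W : IntermediateField K Ω => ∀ x ∈ W, P x) W₂ ∧ IsEmpty (W₁ ≃ₐ[K] W₂) := by
  obtain ⟨W₁, hle₁, hW₁⟩ := exists_le_maximal_of_forall_mem P _ hPθ
  obtain ⟨W₂, hle₂, hW₂⟩ := exists_le_maximal_of_forall_mem P _ hPθ'
  refine ⟨W₁, W₂, hW₁, hW₂, ⟨fun φ => ?_⟩⟩
  let t : W₂ := ⟨θ', hle₂ (IntermediateField.mem_adjoin_simple_self K θ')⟩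
  have hs : aeval ((φ.symm t : W₁) : Ω)
      ((additiveForm p n a).map (algebraMap v.valuationSubring K)) = algebraMap K Ω (c + b) := by
    have h1 : aeval t ((additiveForm p n a).map (algebraMap v.valuationSubring K)) =
        algebraMap K W₂ (c + b) :=
      Subtype.ext ((aeval_algHom_apply W₂.val t _).symm.trans hθ')
    have h2 := aeval_algHom_apply (W₁.val.comp φ.symm.toAlgHom) t
      ((additiveForm p n a).map (algebraMap v.valuationSubring K))
    rw [h1, AlgHom.commutes] at h2
    exact h2
  refine false_of_mem_of_mem ha₀ haₙ hb (W := W₁) (fun x hx => hP x (hW₁.prop x hx)) hval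
    (hle₁ (IntermediateField.mem_adjoin_simple_self K θ)) (φ.symm t).2 ?_
  rw [← aeval_map_additiveForm, ← aeval_map_additiveForm, hs, hθ, map_add, add_sub_cancel_left]

/-- Exponents witnessing pure inseparability of finitely many residues can be taken equal. -/
theorem exists_forall_pow_val_sub_lt_one (v : Valuation K Γ₀) (w : Valuation Ω Γ₁)
    [v.HasExtension w] (p : ℕ) {I : Finset Ω} (hI : ∀ x ∈ I, w x ≤ 1)
    (h : ∀ x ∈ I, ∃ (m : ℕ) (b : K), w (x ^ p ^ m - algebraMap K Ω b) < 1) :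
    ∃ N : ℕ, ∀ x ∈ I, ∃ b : K, w (x ^ p ^ N - algebraMap K Ω b) < 1 := by
  choose! m hm using h
  refine ⟨I.sup m, fun x hx => ?_⟩
  obtain ⟨t, ht⟩ := Nat.exists_eq_add_of_le (Finset.le_sup (f := m) hx)
  let y : w.valuationSubring := ⟨x, hI x hx⟩
  have h1 := (residue_mem_range_iff v w (y ^ p ^ m x)).mpr (hm x hx)
  have h2 := pow_mem h1 (p ^ t)
  rw [← map_pow, ← pow_mul, ← pow_add, ← ht, residue_mem_range_iff] at h2
  exact h2

end Translate

/-! ### The translated extension -/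

section NonUniqueness

variable {K Ω Γ₀ Γ₁ : Type*} [Field K] [CharZero K] [Field Ω] [Algebra K Ω] [IsAlgClosure K Ω]
  [LinearOrderedCommGroupWithZero Γ₀] [LinearOrderedCommGroupWithZero Γ₁]
  {v : Valuation K Γ₀} [HenselianLocalRing v.valuationSubring]
  {w : Valuation Ω Γ₁} [v.HasExtension w]
  {p : ℕ} [Fact p.Prime] [CharP (ResidueField v.valuationSubring) p]
  {n : ℕ} {a : ℕ → v.valuationSubring} {θ : Ω} {c : K}

/-- Some root `θ'` of `𝔄(X) - (c + b)` generates an extension whose values are values of `K(θ)` and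
whose residues are as inseparable over `K` as those of `K(θ)`. -/
theorem exists_translate (ha₀ : v (a 0) = 1) (haₙ : v (a n) = 1)
    (hmin : minpoly K θ = (additiveForm p n a).map (algebraMap v.valuationSubring K) - C c)
    (hval : w θ ^ p ^ n * w (p : Ω) < 1)
    (hwild : ∀ x ∈ K⟮θ⟯, w x ≤ 1 → ∃ (m : ℕ) (b : K), w (x ^ p ^ m - algebraMap K Ω b) < 1)
    (b : v.valuationSubring) :
    ∃ θ' : Ω, aeval θ' ((additiveForm p n a).map (algebraMap v.valuationSubring K)) =
        algebraMap K Ω (c + b) ∧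
      (∀ y ∈ K⟮θ'⟯, ∃ e ∈ K⟮θ⟯, w y = w e) ∧
      ∀ y ∈ K⟮θ'⟯, w y ≤ 1 → ∃ I : Finset Ω, (∀ x ∈ I, x ∈ K⟮θ⟯ ∧ w x ≤ 1) ∧ ∀ N : ℕ,
        (∀ x ∈ I, ∃ b : K, w (x ^ p ^ N - algebraMap K Ω b) < 1) →
        ∃ b : K, w (y ^ p ^ N - algebraMap K Ω b) < 1 := by
  have : IsAlgClosed Ω := IsAlgClosure.isAlgClosed K
  have : Algebra.IsAlgebraic K Ω := IsAlgClosure.isAlgebraic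
  have hint (x : Ω) : IsIntegral K x := Algebra.IsIntegral.isIntegral x
  set f : K[X] := (additiveForm p n a).map (algebraMap v.valuationSubring K) with hf
  have hθ : aeval θ f = algebraMap K Ω c := by
    have h := minpoly.aeval K θ
    rwa [hmin, map_sub, aeval_C, sub_eq_zero] at h
  have hdeg : f.natDegree = (minpoly K θ).natDegree := by rw [hmin, natDegree_sub_C]
  have hpos : 0 < (f - C (c + b)).natDegree := by
    rw [natDegree_sub_C, hdeg]
    exact minpoly.natDegree_pos (hint θ)
  obtain ⟨θ', hθ'⟩ := IsAlgClosed.exists_aeval_eq_zero Ω (f - C (c + b))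
    (natDegree_pos_iff_degree_pos.mp hpos).ne'
  have hθ'c : aeval θ' f = algebraMap K Ω (c + b) := by
    rwa [map_sub, aeval_C, sub_eq_zero] at hθ'
  have hx : (additiveForm p n fun i => algebraMap K Ω (a i)).eval (θ + (θ' - θ)) -
      (additiveForm p n fun i => algebraMap K Ω (a i)).eval θ = algebraMap K Ω b := by
    rw [add_sub_cancel, ← aeval_map_additiveForm, ← aeval_map_additiveForm, hθ, hθ'c, map_add,
      add_sub_cancel_left]
  have hwx := val_le_one_of_eval_add_eq haₙ hval hx
  have hlt := val_eval_sub_lt_one_of_eval_add_eq hval hwx hx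
  have hval' : w θ' ^ p ^ n * w (p : Ω) < 1 := by
    have h1 : w θ' ≤ max (w θ) 1 := by
      have : θ' = θ + (θ' - θ) := by ring
      rw [this]
      exact (w.map_add _ _).trans (max_le_max le_rfl hwx)
    rcases le_max_iff.mp h1 with h2 | h2
    · refine lt_of_le_of_lt ?_ hval
      gcongr
    · rw [mul_comm]
      exact mul_lt_one_of_lt_of_le (val_residueChar_lt_one v w p) (pow_le_one₀ zero_le h2)
  let x : w.valuationSubring := ⟨θ' - θ, hwx⟩
  have hsep := isSeparable_residue_of_val_sub_lt_one ha₀ (x := x) hlt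
  obtain ⟨q, η, hq, hqd, hqη, hη, -⟩ := exists_lift_of_isSeparable v w hsep
  rw [← hη] at hsep hqd
  have hηx : w ((η : Ω) - (θ' - θ)) < 1 := (residue_eq_residue_iff η x).mp hη
  have hηmem (E : IntermediateField K Ω) : (η : Ω) ∈ E ⊔ K⟮(η : Ω)⟯ :=
    le_sup_right (a := E) (IntermediateField.mem_adjoin_simple_self K (η : Ω))
  have hself (t : Ω) : t ∈ K⟮t⟯ ⊔ K⟮(η : Ω)⟯ :=
    le_sup_left (a := K⟮t⟯) (IntermediateField.mem_adjoin_simple_self K t)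
  have hsup : K⟮θ⟯ ⊔ K⟮(η : Ω)⟯ = K⟮θ'⟯ ⊔ K⟮(η : Ω)⟯ := by
    refine le_antisymm (sup_le ?_ le_sup_right) (sup_le ?_ le_sup_right) <;>
      rw [IntermediateField.adjoin_simple_le_iff]
    · refine mem_of_val_sub_lt_one ha₀ hval hθ (sub_mem (hself θ') (hηmem _)) ?_
      convert hηx using 2
      ring
    · refine mem_of_val_sub_lt_one ha₀ hval' hθ'c (add_mem (hself θ) (hηmem _)) ?_
      rw [Valuation.map_sub_swap]
      convert hηx using 2
      ring
  have : FiniteDimensional K K⟮θ⟯ := IntermediateField.adjoin.finiteDimensional (hint θ)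
  have hfin : Module.finrank K K⟮θ'⟯ ≤ Module.finrank K K⟮θ⟯ := by
    rw [IntermediateField.adjoin.finrank (hint θ), IntermediateField.adjoin.finrank (hint θ'),
      ← hdeg, ← natDegree_sub_C (p := f) (a := c + b)]
    exact natDegree_le_of_dvd (minpoly.dvd K θ' hθ') (ne_zero_of_natDegree_gt hpos)
  refine ⟨θ', hθ'c, fun y hy => ?_, fun y hy hwy => ?_⟩
  · have hy' : y ∈ K⟮θ⟯ ⊔ K⟮(η : Ω)⟯ := by
      rw [hsup]
      exact le_sup_left (a := K⟮θ'⟯) hy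
    obtain ⟨-, -, -, -, h⟩ := exists_val_eq_and_eq_sum v w p hwild hsep hq hqη hqd hy'
    exact h
  · exact exists_pow_val_sub_lt_one_of_mem v w p hwild hsep hq hqη hqd hfin hsup
      (y := ⟨y, hwy⟩) hy

end NonUniqueness

end PurelyWild

open PurelyWild in
theorem theorem3p9 {K Ω Γ₀ Γ₁ : Type*} [Field K] [CharZero K]
    [Field Ω] [Algebra K Ω] [IsAlgClosure K Ω]
    [LinearOrderedCommGroupWithZero Γ₀] [LinearOrderedCommGroupWithZero Γ₁]
    (v : Valuation K Γ₀) [HenselianLocalRing v.valuationSubring]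
    (w : Valuation Ω Γ₁) [v.HasExtension w]
    (p : ℕ) [Fact p.Prime] [CharP (ResidueField v.valuationSubring) p]
    (θ : Ω) (hθ : IsPurelyWild p v (restrictTo w K⟮θ⟯))
    (n : ℕ) (a : ℕ → v.valuationSubring) (c : K)
    (hmin : minpoly K θ =
      (additiveForm p n a).map (algebraMap v.valuationSubring K) - C c)
    (ha₀ : v (a 0) = 1) (haₙ : v (a n) = 1)
    -- additively: `p ^ n * νθ + νp > 0`
    (hval : w θ ^ p ^ n * w (p : Ω) < 1)
    (hclosed : ¬ IsPolyClosed ((additiveForm p n a).map (residue v.valuationSubring))) :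
    (∃ W₁ W₂ : IntermediateField K Ω,
      IsMaximalPurelyWild p v w W₁ ∧ IsMaximalPurelyWild p v w W₂ ∧ IsEmpty (W₁ ≃ₐ[K] W₂)) ∧
    (IsImmediate v (restrictTo w K⟮θ⟯) →
      ∃ W₁ W₂ : IntermediateField K Ω,
        IsMaximalImmediateAlgebraic v w W₁ ∧ IsMaximalImmediateAlgebraic v w W₂ ∧
          IsEmpty (W₁ ≃ₐ[K] W₂)) := by
  have : Algebra.IsAlgebraic K Ω := IsAlgClosure.isAlgebraic
  obtain ⟨b, hb⟩ : ∃ b : v.valuationSubring, residue v.valuationSubring b ∉ Set.range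
      fun y => ((additiveForm p n a).map (residue v.valuationSubring)).eval y := by
    rw [IsPolyClosed, Set.eq_univ_iff_forall] at hclosed
    push Not at hclosed
    obtain ⟨z, hz⟩ := hclosed
    obtain ⟨b, rfl⟩ := residue_surjective z
    exact ⟨b, hz⟩
  rw [isPurelyWild_restrictTo_iff] at hθ
  obtain ⟨θ', hθ', hval', hres'⟩ :=
    exists_translate ha₀ haₙ hmin hval (fun x hx => (hθ x hx).2) b
  have hθc : aeval θ ((additiveForm p n a).map (algebraMap v.valuationSubring K)) =
      algebraMap K Ω c := by
    have h := minpoly.aeval K θ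
    rwa [hmin, map_sub, aeval_C, sub_eq_zero] at h
  have hne {y e : Ω} (hy : y ≠ 0) (hye : w y = w e) : e ≠ 0 := by
    rintro rfl
    rw [map_zero, map_eq_zero] at hye
    exact hy hye
  constructor
  · simp only [IsMaximalPurelyWild, isPurelyWild_restrictTo_iff]
    refine exists_maximal_not_algEquiv ha₀ haₙ hb hval hθc hθ' _ (fun x hx => hx.2) hθ
      fun y hy => ⟨fun hy0 => ?_, fun hwy => ?_⟩
    · obtain ⟨e, he, hye⟩ := hval' y hy
      rw [hye]
      exact (hθ e he).1 (hne hy0 hye)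
    · obtain ⟨I, hI, hN⟩ := hres' y hy hwy
      obtain ⟨N, h⟩ := exists_forall_pow_val_sub_lt_one v w p (fun x hx => (hI x hx).2)
        fun x hx => (hθ x (hI x hx).1).2 (hI x hx).2
      exact ⟨N, hN N h⟩
  · intro himm
    rw [isImmediate_restrictTo_iff] at himm
    simp only [IsMaximalImmediateAlgebraic, isImmediate_restrictTo_iff]
    have halg (M : IntermediateField K Ω) : Algebra.IsAlgebraic K M := inferInstance
    simp only [halg, true_and]
    refine exists_maximal_not_algEquiv ha₀ haₙ hb hval hθc hθ' _
      (fun x hx hwx => ⟨0, by simpa using hx.2 hwx⟩) himm fun y hy => ⟨fun hy0 => ?_, fun hwy => ?_⟩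
    · obtain ⟨e, he, hye⟩ := hval' y hy
      rw [hye]
      exact (himm e he).1 (hne hy0 hye)
    · obtain ⟨I, hI, hN⟩ := hres' y hy hwy
      simpa using hN 0 fun x hx => by simpa using (himm x (hI x hx).1).2 (hI x hx).2
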